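/- Let $n\ge 1$ and let $\mathrm{Sym}(\mathbb R^n)$ be the space of real symmetric $n\times n$ matrices, $\mathcal P=\{A\in \mathrm{Sym}(\mathbb R^n): A\ge 0\}$. A *subequation* is a closed set $F\subset \mathrm{Sym}(\mathbb R^n)$ with $F+\mathcal P\subset F$; it is *borderline* if $F\cap(-\mathcal P)=\{0\}$. A function $u:X\to[-\infty,\infty)$ on an open set $X\subset\mathbb R^n$ is *$F$-subharmonic* if it is upper semicontinuous and $D^2_x\varphi\in F$ whenever $x\in X$ and $\varphi$ is a real-valued $C^2$ function near $x$ with $u\le\varphi$ near $x$ and $u(x)=\varphi(x)$. The *strong maximum principle* (SMP) holds for $F$ if for every compact $K\subset\mathbb R^n$ with connected interior and every upper semicontinuous $u:K\to[-\infty,\infty)$ that is $F$-subharmonic on $\mathrm{Int}\,K$: if $u$ attains its maximum over $K$ at a point of $\mathrm{Int}\,K$, then $u$ is constant on $\overline{\mathrm{Int}\,K}$ (so on $K$ if $K=\overline{\mathrm{Int}\,K}$). For $e\neq 0$ let $P_e$ and $P_{e^\perp}=I-P_e$ be the orthogonal projections onto $\mathbb R e$ and $e^\perp$. The *upper and lower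 characteristic functions* of $F$ are $$\overline f(\lambda)=\sup\{\mu\in\mathbb R:\lambda P_{e^\perp}-\mu P_e\in F\text{ for some }e\ne0\},\qquad \underline f(\lambda)=\sup\{\mu\in\mathbb R:\lambda P_{e^\perp}-\mu P_e\in F\text{ for all }e\ne0\},$$ with values in $[-\infty,\infty]$. With $1/0=\infty$ and $1/\infty=0$, $\int_{0^+}dy/f(y)=\infty$ means $\int_0^\varepsilon dy/f(y)=\infty$ for every $\varepsilon>0$, and $\int_{0^+}dy/f(y)<\infty$ means that $\int_0^\varepsilon dy/f(y)<\infty$ for some $\varepsilon>0$. **Theorem.** Let $F$ be a borderline subequation on $\mathbb R^n$. (a) If $\int_{0^+}dy/\overline f(y)=\infty$, then the SMP holds for $F$. (b) If $\int_{0^+}dy/\underline f(y)<\infty$, then the SMP fails for $F$. More precisely, there are also $t_0>1$, $m\in\mathbb R$ and a non-decreasing function $\psi$ of class $C^{1,1}$ on $(1,\infty)$ (differentiable with Lipschitz derivative) with $\psi(t)<m$ for $1<t<t_0$ and $\psi(t)=m$ for $t\ge t_0$, such that $u(x)=\psi(|x|)$ is $F$-subharmonic on $\{|x|>1\}$. (c)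 Suppose $F$ is invariant: for all $\lambda,\mu\in\mathbb R$, if $\lambda P_{e^\perp}+\mu P_e\in F$ for one $e\neq0$, then for all $e\ne0$. Then $\overline f=\underline f=:f$, and the SMP holds for $F$ if and only if $\int_{0^+}dy/f(y)=\infty$. -/

import Mathlib

open Set Filter Topology MeasureTheory

namespace PureSecondOrder

/-- A (constant coefficient, pure second-order) subequation on `ℝⁿ`: a closed set `F` of symmetric
real `n × n` matrices with `F + 𝒫 ⊆ F`, where `𝒫` is the cone of positive semidefinite matrices. -/
structure IsSubequation {n : ℕ} (F : Set (Matrix (Fin n) (Fin n) ℝ)) : Prop where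
  isSymm : ∀ A ∈ F, A.IsSymm
  isClosed : IsClosed F
  positivity : ∀ A ∈ F, ∀ P : Matrix (Fin n) (Fin n) ℝ, P.PosSemidef → A + P ∈ F

/-- `F` is borderline: `F ∩ (-𝒫) = {0}`. -/
def IsBorderline {n : ℕ} (F : Set (Matrix (Fin n) (Fin n) ℝ)) : Prop :=
  F ∩ {A | (-A).PosSemidef} = {0}

/-- The orthogonal projection `P_e` onto the line spanned by `e ≠ 0`. -/
noncomputable def projLine {n : ℕ} (e : Fin n → ℝ) : Matrix (Fin n) (Fin n) ℝ :=
  (e ⬝ᵥ e)⁻¹ • Matrix.vecMulVec e e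

/-- The orthogonal projection `P_{e^⊥} = I - P_e` onto the hyperplane perpendicular to `e ≠ 0`. -/
noncomputable def projPerp {n : ℕ} (e : Fin n → ℝ) : Matrix (Fin n) (Fin n) ℝ :=
  1 - projLine e

/-- The upper characteristic function
`λ ↦ sup {μ : λ P_{e^⊥} - μ P_e ∈ F for some e ≠ 0}`, with values in `[-∞, ∞]`. -/
noncomputable def upperChar {n : ℕ} (F : Set (Matrix (Fin n) (Fin n) ℝ)) (l : ℝ) : EReal :=
  sSup ((fun μ : ℝ => (μ : EReal)) ''
    {μ : ℝ | ∃ e : Fin n → ℝ, e ≠ 0 ∧ l • projPerp e - μ • projLine e ∈ F})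

/-- The lower characteristic function
`λ ↦ sup {μ : λ P_{e^⊥} - μ P_e ∈ F for all e ≠ 0}`, with values in `[-∞, ∞]`. -/
noncomputable def lowerChar {n : ℕ} (F : Set (Matrix (Fin n) (Fin n) ℝ)) (l : ℝ) : EReal :=
  sSup ((fun μ : ℝ => (μ : EReal)) ''
    {μ : ℝ | ∀ e : Fin n → ℝ, e ≠ 0 → l • projPerp e - μ • projLine e ∈ F})

/-- Invariance: if `λ P_{e^⊥} + μ P_e ∈ F` for one `e ≠ 0`, then for all `e ≠ 0`. -/
def IsInvariant {n : ℕ} (F : Set (Matrix (Fin n) (Fin n) ℝ)) : Prop :=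
  ∀ l μ : ℝ, (∃ e : Fin n → ℝ, e ≠ 0 ∧ l • projPerp e + μ • projLine e ∈ F) →
    ∀ e : Fin n → ℝ, e ≠ 0 → l • projPerp e + μ • projLine e ∈ F

/-- The integral `∫_0^ε dy / f(y) ∈ [0, ∞]` for `f ≥ 0` on `(0, ε]`,
with the conventions `1/0 = ∞` and `1/∞ = 0`. -/
noncomputable def recipIntegral (f : ℝ → EReal) (ε : ℝ) : ENNReal :=
  ∫⁻ y in Ioc 0 ε, ((f y).toENNReal)⁻¹

/-- `∫_{0+} dy / f(y) = ∞`: the integral over every interval `(0, ε]` is infinite. -/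
def IntegralDivergesAtZero (f : ℝ → EReal) : Prop :=
  ∀ ε : ℝ, 0 < ε → recipIntegral f ε = ⊤

/-- `∫_{0+} dy / f(y) < ∞`: the integral over some interval `(0, ε]` is finite. -/
def IntegralConvergesAtZero (f : ℝ → EReal) : Prop :=
  ∃ ε : ℝ, 0 < ε ∧ recipIntegral f ε < ⊤

/-- The Hessian matrix `D²_x φ`, with entries the second partial derivatives at `x`. -/
noncomputable def hessian {n : ℕ} (φ : EuclideanSpace ℝ (Fin n) → ℝ)
    (x : EuclideanSpace ℝ (Fin n)) : Matrix (Fin n) (Fin n) ℝ :=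
  Matrix.of fun i j =>
    fderiv ℝ (fderiv ℝ φ) x (EuclideanSpace.single i 1) (EuclideanSpace.single j 1)

/-- `u` is `F`-subharmonic on the (open) set `X`: it is upper semicontinuous on `X` with values in
`[-∞, ∞)`, and for each `x ∈ X` and each test function `φ` for `u` at `x` (that is, `φ` is real
valued and `C²` near `x`, `u ≤ φ` near `x`, and `u(x) = φ(x)`) one has `D²_x φ ∈ F`. -/
structure IsSubharmonicOn {n : ℕ} (F : Set (Matrix (Fin n) (Fin n) ℝ))
    (X : Set (EuclideanSpace ℝ (Fin n))) (u : EuclideanSpace ℝ (Fin n) → EReal) : Prop where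
  usc : UpperSemicontinuousOn u X
  ne_top : ∀ x ∈ X, u x ≠ ⊤
  test : ∀ x ∈ X, ∀ φ : EuclideanSpace ℝ (Fin n) → ℝ, ContDiffAt ℝ 2 φ x →
    (∀ᶠ y in 𝓝 x, u y ≤ (φ y : EReal)) → u x = (φ x : EReal) → hessian φ x ∈ F

/-- The strong maximum principle for `F`: for every compact `K ⊆ ℝⁿ` with connected interior and
every upper semicontinuous `u : K → [-∞, ∞)` that is `F`-subharmonic on the interior of `K`, if `u`
attains its maximum over `K` at an interior point of `K`, then `u` is constant on the closure of
the interior of `K` (which is `K` itself unless `K` has points away from its interior, where no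
condition on `u` beyond semicontinuity is imposed). -/
def StrongMaxPrinciple {n : ℕ} (F : Set (Matrix (Fin n) (Fin n) ℝ)) : Prop :=
  ∀ (K : Set (EuclideanSpace ℝ (Fin n))) (u : EuclideanSpace ℝ (Fin n) → EReal),
    IsCompact K → IsConnected (interior K) →
    UpperSemicontinuousOn u K → (∀ x ∈ K, u x ≠ ⊤) → IsSubharmonicOn F (interior K) u →
    (∃ x₀ ∈ interior K, ∀ x ∈ K, u x ≤ u x₀) →
    ∃ c : EReal, ∀ x ∈ closure (interior K), u x = c

end PureSecondOrder

namespace PureSecondOrder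

/-! ### Second-order calculus: Hessians at minima and Hessians of radial polynomials. -/

section Hessian

variable {n : ℕ}

/-! The Hessian of a radial function `ψ(|x|)` at distance `t` is `(ψ'/t) P_{e^⊥} + ψ'' P_e`, with
`e` the radial direction. With `g = ψ'`, subharmonicity of an increasing radial function is thus the
inequality `-g' ≤ f(g/t)` for a characteristic function `f`. A decreasing solution of `-g' = f(g)`
reaches zero in finite time exactly when `∫ dy/f(y)` converges at zero; this dichotomy decides the
strong maximum principle. As `f` is only monotone, the equation is replaced by two-sided difference
inequalities, obtained by inverting the primitive of `1/f` (`exists_decreasing_flow`).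

Divergent case: for the upper function there is a `g` staying positive across a whole annulus with
`-g' ≥ f(g/t)` (`exists_barrier`). Its primitive, bent down by a small multiple of the squared
radius, is a radial barrier violating `F` in every direction. Comparison gives a Hopf lemma
(`not_isMax_on_sphere`): the maximum cannot be taken on the sphere of a ball in which `u` stays
below it. Touching the contact set from inside by such a ball, and connectedness, finish the
argument.

Convergent case: for the lower function `g` hits zero at a finite `t₀`. Its primitive increases
strictly up to `t₀` and is constant afterwards. It is subharmonic because the lower function
controls all directions at once, and a ball centred at radius `t₀` refutes the principle.

Neither profile need be `C²`. In both cases it is touched by a polynomial in the squared radius with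
prescribed second derivative (`eventually_le_quartic`). For invariant `F` the two characteristic
functions agree, and divergence and convergence are complementary. -/

theorem dotProduct_hessian_mulVec (φ : EuclideanSpace ℝ (Fin n) → ℝ)
    (x : EuclideanSpace ℝ (Fin n)) (v : Fin n → ℝ) :
    v ⬝ᵥ (hessian φ x).mulVec v =
      fderiv ℝ (fderiv ℝ φ) x (WithLp.toLp 2 v) (WithLp.toLp 2 v) := by
  have hv : (WithLp.toLp 2 v : EuclideanSpace ℝ (Fin n)) =
      ∑ i, v i • EuclideanSpace.single i (1 : ℝ) := by
    ext j
    simp [Finset.sum_apply, Pi.single_apply]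
  rw [hv]
  simp only [map_sum, map_smul, sum_apply, smul_apply,
    hessian, dotProduct, Matrix.mulVec, Matrix.of_apply, smul_eq_mul, Finset.mul_sum]
  rw [Finset.sum_comm]
  refine Finset.sum_congr rfl fun i _ => Finset.sum_congr rfl fun j _ => ?_
  ring

theorem differentiableAt_fderiv_of_contDiffAt {φ : EuclideanSpace ℝ (Fin n) → ℝ}
    {x : EuclideanSpace ℝ (Fin n)} (h : ContDiffAt ℝ 2 φ x) :
    DifferentiableAt ℝ (fderiv ℝ φ) x :=
  (h.fderiv_right (m := 1) (by norm_num)).differentiableAt (by norm_num)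

theorem eventually_differentiableAt_of_contDiffAt {φ : EuclideanSpace ℝ (Fin n) → ℝ}
    {x : EuclideanSpace ℝ (Fin n)} (h : ContDiffAt ℝ 2 φ x) :
    ∀ᶠ y in 𝓝 x, DifferentiableAt ℝ φ y := by
  filter_upwards [h.eventually (by simp)] with y hy
  exact hy.differentiableAt (by norm_num)

theorem hessian_add {φ w : EuclideanSpace ℝ (Fin n) → ℝ} {x : EuclideanSpace ℝ (Fin n)}
    (hφ : ContDiffAt ℝ 2 φ x) (hw : ContDiffAt ℝ 2 w x) :
    hessian (fun y => φ y + w y) x = hessian φ x + hessian w x := by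
  have h1 : fderiv ℝ (fun y => φ y + w y) =ᶠ[𝓝 x] fun y => fderiv ℝ φ y + fderiv ℝ w y := by
    filter_upwards [eventually_differentiableAt_of_contDiffAt hφ,
      eventually_differentiableAt_of_contDiffAt hw] with y h1 h2
    exact fderiv_fun_add h1 h2
  ext i j
  simp only [hessian, Matrix.of_apply, Matrix.add_apply]
  rw [h1.fderiv_eq, fderiv_fun_add (differentiableAt_fderiv_of_contDiffAt hφ)
    (differentiableAt_fderiv_of_contDiffAt hw)]
  simp

/-- If `a < 0`, the point is also a local maximum, so `f` is locally constant and its second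
derivative vanishes, a contradiction. -/
theorem second_deriv_nonneg_of_isLocalMin {f f' : ℝ → ℝ} {x a : ℝ} (h : IsLocalMin f x)
    (hf : ∀ᶠ y in 𝓝 x, HasDerivAt f (f' y) y) (hf' : HasDerivAt f' a x) : 0 ≤ a := by
  by_contra! ha
  have hd : deriv f =ᶠ[𝓝 x] f' := by
    filter_upwards [hf] with y hy using hy.deriv
  have hdd : deriv (deriv f) x = a := by rw [hd.deriv_eq, hf'.deriv]
  have hd0 : deriv f x = 0 := h.deriv_eq_zero
  have hmax : IsLocalMax f x :=
    isLocalMax_of_deriv_deriv_neg (by rw [hdd]; exact ha) hd0 hf.self_of_nhds.continuousAt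
  have hconst : f =ᶠ[𝓝 x] fun _ => f x := by
    filter_upwards [h, hmax] with y h1 h2 using le_antisymm h2 h1
  have h0 : deriv (deriv f) x = 0 := by
    rw [hconst.deriv.deriv_eq]
    simp
  linarith

theorem hessian_posSemidef_of_isLocalMin {φ : EuclideanSpace ℝ (Fin n) → ℝ}
    {x : EuclideanSpace ℝ (Fin n)} (hφ : ContDiffAt ℝ 2 φ x) (h : IsLocalMin φ x) :
    (hessian φ x).PosSemidef := by
  refine Matrix.PosSemidef.of_dotProduct_mulVec_nonneg ?_ fun v => ?_
  · ext i j
    simpa [hessian] using (hφ.isSymmSndFDerivAt (by simp)).eq _ _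
  · rw [star_trivial, dotProduct_hessian_mulVec]
    set w : EuclideanSpace ℝ (Fin n) := WithLp.toLp 2 v
    have hline : ∀ s : ℝ, HasDerivAt (fun s : ℝ => x + s • w) w s := fun s => by
      simpa using ((hasDerivAt_id s).smul_const w).const_add x
    have hcont : Tendsto (fun s : ℝ => x + s • w) (𝓝 0) (𝓝 x) := by
      simpa using (hline 0).continuousAt.tendsto
    refine second_deriv_nonneg_of_isLocalMin (f := fun s : ℝ => φ (x + s • w))
      (f' := fun s : ℝ => fderiv ℝ φ (x + s • w) w) (x := 0) ?_ ?_ ?_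
    · have := hcont.eventually h
      filter_upwards [this] with s hs
      simpa using hs
    · filter_upwards [hcont.eventually (eventually_differentiableAt_of_contDiffAt hφ)] with s hs
      exact hs.hasFDerivAt.comp_hasDerivAt s (hline s)
    · have h2 : HasFDerivAt (fderiv ℝ φ) (fderiv ℝ (fderiv ℝ φ) x) (x + (0 : ℝ) • w) := by
        simpa using (differentiableAt_fderiv_of_contDiffAt hφ).hasFDerivAt
      have h3 := h2.comp_hasDerivAt (0 : ℝ) (hline 0)
      simpa using h3.clm_apply (hasDerivAt_const (0 : ℝ) w)

/-- A function of `‖y - c‖` that is a quadratic polynomial in `‖y - c‖² - t²`. -/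
noncomputable def radialQuartic (c : EuclideanSpace ℝ (Fin n)) (t a b d : ℝ)
    (y : EuclideanSpace ℝ (Fin n)) : ℝ :=
  a + b * (‖y - c‖ ^ 2 - t ^ 2) + d * (‖y - c‖ ^ 2 - t ^ 2) ^ 2

theorem contDiff_radialQuartic (c : EuclideanSpace ℝ (Fin n)) (t a b d : ℝ) :
    ContDiff ℝ 2 (radialQuartic c t a b d) := by
  have h : ContDiff ℝ 2 fun y : EuclideanSpace ℝ (Fin n) => ‖y - c‖ ^ 2 :=
    (contDiff_id.sub contDiff_const).norm_sq ℝ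
  exact (contDiff_const.add (contDiff_const.mul (h.sub contDiff_const))).add
    (contDiff_const.mul ((h.sub contDiff_const).pow 2))

/-- Since `‖y - c‖² - t²` vanishes at `x` and has gradient `2 (x - c)`, the Hessian is `2b I + 8d (x
- c) ⊗ (x - c)`, and the tensor square is `t² P_e`. The parameters `b` and `d` therefore set the two
eigenvalues independently. -/
theorem hessian_radialQuartic (c : EuclideanSpace ℝ (Fin n)) {t : ℝ} (a b d : ℝ)
    {x : EuclideanSpace ℝ (Fin n)} (hx : ‖x - c‖ = t) (ht : 0 < t) :
    hessian (radialQuartic c t a b d) x = (2 * b) • projPerp (WithLp.ofLp (x - c)) +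
      (2 * b + 8 * d * t ^ 2) • projLine (WithLp.ofLp (x - c)) := by
  have hs : ∀ y : EuclideanSpace ℝ (Fin n), HasFDerivAt (fun y => ‖y - c‖ ^ 2)
      ((2 : ℝ) • innerSL ℝ (y - c)) y := fun y => by
    refine ((hasFDerivAt_id y).sub_const c).norm_sq.congr_fderiv ?_
    ext v
    simp [two_smul]
  have h1 : fderiv ℝ (radialQuartic c t a b d) = fun y =>
      (2 * b + 4 * d * (‖y - c‖ ^ 2 - t ^ 2)) • innerSL ℝ (y - c) := by
    funext y
    have h := (((hs y).sub_const (t ^ 2)).const_mul b).const_add a |>.add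
      ((((hs y).sub_const (t ^ 2)).pow 2).const_mul d)
    refine (HasFDerivAt.congr_fderiv h ?_).fderiv
    ext v
    simp
    ring
  have h2 : HasFDerivAt (fun y => (innerSL ℝ (y - c) : EuclideanSpace ℝ (Fin n) →L[ℝ] ℝ))
      (innerSL ℝ) x :=
    ((innerSL ℝ : EuclideanSpace ℝ (Fin n) →L[ℝ] _).hasFDerivAt).comp x
      ((hasFDerivAt_id x).sub_const c)
  have h3 := (((((hs x).sub_const (t ^ 2)).const_mul (4 * d)).const_add (2 * b))).smul h2
  have hne : (WithLp.ofLp (x - c)) ⬝ᵥ (WithLp.ofLp (x - c)) = t ^ 2 := by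
    rw [← hx, EuclideanSpace.norm_sq_eq]
    simp [dotProduct, sq]
  ext i j
  simp only [hessian, Matrix.of_apply, h1]
  erw [h3.fderiv]
  simp only [Matrix.add_apply, Matrix.smul_apply, projPerp, projLine, Matrix.sub_apply,
    hne, Matrix.vecMulVec_apply, smul_eq_mul, Matrix.one_apply]
  have hin : (innerSL ℝ) (EuclideanSpace.single i (1 : ℝ)) (EuclideanSpace.single j 1) =
      if i = j then (1 : ℝ) else 0 := by
    rw [innerSL_apply_apply, EuclideanSpace.inner_single_left]
    simp
  simp [hx, EuclideanSpace.inner_single_right]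
  erw [hin]
  field_simp
  split_ifs <;> ring

end Hessian


/-! ### One-variable analysis: the flow of a monotone function and touching polynomials. -/

/-- Solution of the differential inequality `-g' ≈ h(g)` by inverting the primitive of `1/h`. -/
theorem exists_decreasing_flow {h : ℝ → ℝ} {a b : ℝ} (hab : a ≤ b)
    (hmono : MonotoneOn h (Icc a b)) (hpos : ∀ y ∈ Ioc a b, 0 < h y) (ha : 0 ≤ h a)
    (hint : IntervalIntegrable (fun y => (h y)⁻¹) volume a b) :
    ∃ g : ℝ → ℝ, (∀ t ∈ Icc 0 (∫ y in a..b, (h y)⁻¹), g t ∈ Icc a b) ∧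
      g (∫ y in a..b, (h y)⁻¹) = a ∧
      (∀ t, 0 ≤ t → t < ∫ y in a..b, (h y)⁻¹ → a < g t) ∧
      ∀ s t, 0 ≤ s → s ≤ t → t ≤ (∫ y in a..b, (h y)⁻¹) →
        h (g t) * (t - s) ≤ g s - g t ∧ g s - g t ≤ h (g s) * (t - s) := by
  set T := ∫ y in a..b, (h y)⁻¹ with hT
  set G : ℝ → ℝ := fun x => ∫ y in a..x, (h y)⁻¹ with hG
  have hii : ∀ p ∈ Icc a b, ∀ q ∈ Icc a b,
      IntervalIntegrable (fun y => (h y)⁻¹) volume p q := fun p hp q hq =>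
    hint.mono_set (by rw [uIcc_of_le hab]; exact uIcc_subset_Icc hp hq)
  have hGc : ContinuousOn G (Icc a b) := by
    have := intervalIntegral.continuousOn_primitive_interval (a := a) (b := b)
      (f := fun y => (h y)⁻¹) (μ := volume)
      (by rw [uIcc_of_le hab, integrableOn_Icc_iff_integrableOn_Ioc]
          exact (intervalIntegrable_iff_integrableOn_Ioc_of_le hab).1 hint)
    rwa [uIcc_of_le hab] at this
  have hsub : ∀ p ∈ Icc a b, ∀ q ∈ Icc a b, G q - G p = ∫ y in p..q, (h y)⁻¹ :=
    fun p hp q hq => by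
      have hA := left_mem_Icc.2 hab
      exact intervalIntegral.integral_interval_sub_left (hii a hA q hq) (hii a hA p hp)
  have hup : ∀ p ∈ Icc a b, ∀ q ∈ Icc a b, p ≤ q → q - p ≤ h q * (G q - G p) := by
    intro p hp q hq hpq
    rcases hpq.eq_or_lt with rfl | hlt
    · simp
    have hq0 : 0 < h q := hpos q ⟨hp.1.trans_lt hlt, hq.2⟩
    have : (q - p) * (h q)⁻¹ ≤ G q - G p := by
      rw [hsub p hp q hq]
      have h1 : ∫ y in p..q, (h q)⁻¹ = (q - p) * (h q)⁻¹ := by simp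
      rw [← h1]
      refine intervalIntegral.integral_mono_on_of_le_Ioo hpq (by simp) (hii p hp q hq) fun y hy => ?_
      have hy' : y ∈ Icc a b := ⟨hp.1.trans hy.1.le, hy.2.le.trans hq.2⟩
      exact inv_anti₀ (hpos y ⟨hp.1.trans_lt hy.1, hy'.2⟩) (hmono hy' hq hy.2.le)
    calc q - p = h q * ((q - p) * (h q)⁻¹) := by field_simp
      _ ≤ _ := by gcongr
  have hlow : ∀ p ∈ Icc a b, ∀ q ∈ Icc a b, p ≤ q → h p * (G q - G p) ≤ q - p := by
    intro p hp q hq hpq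
    have hp0 : 0 ≤ h p := ha.trans (hmono (left_mem_Icc.2 hab) hp hp.1)
    -- The value zero is possible only at `p = a`; there the bound is just `p ≤ q`.
    rcases hp0.eq_or_lt with h0 | hp0
    · rw [← h0]; simpa using hpq
    have : G q - G p ≤ (q - p) * (h p)⁻¹ := by
      rw [hsub p hp q hq]
      have h1 : ∫ y in p..q, (h p)⁻¹ = (q - p) * (h p)⁻¹ := by simp
      rw [← h1]
      refine intervalIntegral.integral_mono_on_of_le_Ioo hpq (hii p hp q hq) (by simp) fun y hy => ?_
      have hy' : y ∈ Icc a b := ⟨hp.1.trans hy.1.le, hy.2.le.trans hq.2⟩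
      exact inv_anti₀ hp0 (hmono hp hy' hy.1.le)
    calc h p * (G q - G p) ≤ h p * ((q - p) * (h p)⁻¹) := by gcongr
      _ = _ := by field_simp
  have hGa : G a = 0 := by simp [hG]
  have hGb : G b = T := rfl
  have hsm : ∀ p ∈ Icc a b, ∀ q ∈ Icc a b, p < q → G p < G q := by
    intro p hp q hq hpq
    by_contra! hle
    have hq0 : 0 < h q := hpos q ⟨hp.1.trans_lt hpq, hq.2⟩
    have := hup p hp q hq hpq.le
    nlinarith
  -- The flow starts at `b` and has remaining lifetime `G y` when at height `y`, so its position at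
  -- time `t` solves `G y = T - t`.
  have hex : ∀ t, ∃ y, t ∈ Icc 0 T → y ∈ Icc a b ∧ G y = T - t := by
    intro t
    by_cases ht : t ∈ Icc 0 T
    · have : T - t ∈ Icc (G a) (G b) := by
        rw [hGa, hGb]; constructor <;> linarith [ht.1, ht.2]
      obtain ⟨y, hy, hy'⟩ := intermediate_value_Icc hab hGc this
      exact ⟨y, fun _ => ⟨hy, hy'⟩⟩
    · exact ⟨0, fun h => absurd h ht⟩
  choose g hg using hex
  have hT0 : 0 ≤ T := by
    rcases hab.eq_or_lt with h | h
    · simp [hT, h]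
    · rw [← hGb, ← hGa]; exact (hsm a (left_mem_Icc.2 hab) b (right_mem_Icc.2 hab) h).le
  have hle : ∀ t ∈ Icc 0 T, t ≠ T → a < g t := by
    intro t ht hne
    have h1 := hg t ht
    rcases h1.1.1.eq_or_lt with h | h
    · rw [← h, hGa] at h1
      exact absurd (by linarith [h1.2]) hne
    · exact h
  refine ⟨g, fun t ht => (hg t ht).1, ?_, fun t h0 ht => hle t ⟨h0, ht.le⟩ ht.ne, ?_⟩
  · have h1 := hg T ⟨hT0, le_rfl⟩
    rcases h1.1.1.eq_or_lt with h | h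
    · exact h.symm
    · have := hsm a (left_mem_Icc.2 hab) _ h1.1 h
      rw [h1.2, hGa] at this
      simp at this
  · intro s t hs hst ht
    have h1 := hg s ⟨hs, hst.trans ht⟩
    have h2 := hg t ⟨hs.trans hst, ht⟩
    have hgg : g t ≤ g s := by
      by_contra! hlt
      have := hsm _ h1.1 _ h2.1 hlt
      rw [h1.2, h2.2] at this
      linarith
    have e : G (g s) - G (g t) = t - s := by rw [h1.2, h2.2]; ring
    have h3 := hup _ h2.1 _ h1.1 hgg
    have h4 := hlow _ h2.1 _ h1.1 hgg
    rw [e] at h3 h4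
    exact ⟨h4, h3⟩

/-- Extension to the whole line of the solution of `exists_decreasing_flow`. -/
theorem exists_decreasing_flow_real {h : ℝ → ℝ} {a b : ℝ} (hab : a ≤ b)
    (hmono : MonotoneOn h (Icc a b)) (hpos : ∀ y ∈ Ioc a b, 0 < h y) (ha : 0 ≤ h a)
    (hint : IntervalIntegrable (fun y => (h y)⁻¹) volume a b) :
    ∃ g : ℝ → ℝ, (∀ t, g t ∈ Icc a b) ∧
      (∀ t, (∫ y in a..b, (h y)⁻¹) ≤ t → g t = a) ∧
      (∀ t, 0 ≤ t → t < ∫ y in a..b, (h y)⁻¹ → a < g t) ∧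
      (∀ s t, s ≤ t → 0 ≤ g s - g t ∧ g s - g t ≤ h (g s) * (t - s)) ∧
      (∀ s t, 0 ≤ s → s ≤ t → t ≤ (∫ y in a..b, (h y)⁻¹) → h (g t) * (t - s) ≤ g s - g t) ∧
      LipschitzWith (h b).toNNReal g := by
  obtain ⟨g, hg, hgT, hga, hflow⟩ := exists_decreasing_flow hab hmono hpos ha hint
  set T := ∫ y in a..b, (h y)⁻¹ with hT
  have hh0 : ∀ y ∈ Icc a b, 0 ≤ h y := fun y hy =>
    ha.trans (hmono (left_mem_Icc.2 hab) hy hy.1)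
  have hT0 : 0 ≤ T := intervalIntegral.integral_nonneg hab fun y hy => inv_nonneg.2 (hh0 y hy)
  -- Clamping time to `[0, T]` is monotone and 1-Lipschitz, so the upper bound on the decrease
  -- survives everywhere; the lower bound survives only inside `[0, T]`.
  set p : ℝ → ℝ := fun t => max 0 (min T t) with hp
  have hpI : ∀ t, p t ∈ Icc 0 T := fun t => ⟨le_max_left _ _, max_le hT0 (min_le_left _ _)⟩
  have hpid : ∀ t ∈ Icc 0 T, p t = t := fun t ht => by
    simp [hp, min_eq_right ht.2, max_eq_right ht.1]
  have hpm : ∀ s t, s ≤ t → p s ≤ p t := fun s t hst =>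
    max_le_max le_rfl (min_le_min le_rfl hst)
  have hpl : ∀ s t, s ≤ t → p t - p s ≤ t - s := fun s t hst => by
    simp only [hp]
    rcases max_cases 0 (min T t) with h1 | h1 <;> rcases max_cases 0 (min T s) with h2 | h2 <;>
    rcases min_cases T t with h3 | h3 <;> rcases min_cases T s with h4 | h4 <;> linarith
  have hmain : ∀ s t, s ≤ t →
      0 ≤ g (p s) - g (p t) ∧ g (p s) - g (p t) ≤ h (g (p s)) * (t - s) := by
    intro s t hst
    obtain ⟨h1, h2⟩ := hflow _ _ (hpI s).1 (hpm s t hst) (hpI t).2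
    have hs := hh0 _ (hg _ (hpI s))
    have ht := hh0 _ (hg _ (hpI t))
    exact ⟨(mul_nonneg ht (sub_nonneg.2 (hpm s t hst))).trans h1,
      h2.trans (mul_le_mul_of_nonneg_left (hpl s t hst) hs)⟩
  refine ⟨fun t => g (p t), fun t => hg _ (hpI t), fun t ht => ?_, fun t h0 ht => ?_, hmain,
    fun s t hs hst ht => ?_, ?_⟩
  · have : p t = T := by simp [hp, min_eq_left ht, hT0]
    simp only [this, hgT]
  · simp only [hpid t ⟨h0, ht.le⟩]
    exact hga t h0 ht
  · simp only [hpid s ⟨hs, hst.trans ht⟩, hpid t ⟨hs.trans hst, ht⟩]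
    exact (hflow s t hs hst ht).1
  · have hb := hh0 b (right_mem_Icc.2 hab)
    have key : ∀ s t, s ≤ t → |g (p s) - g (p t)| ≤ h b * (t - s) := fun s t hst => by
      obtain ⟨h1, h2⟩ := hmain s t hst
      rw [abs_of_nonneg h1]
      have hs := hg _ (hpI s)
      exact h2.trans (mul_le_mul_of_nonneg_right
        (hmono hs (right_mem_Icc.2 hab) hs.2) (sub_nonneg.2 hst))
    refine LipschitzWith.of_dist_le_mul fun s t => ?_
    rw [Real.coe_toNNReal _ hb, Real.dist_eq, Real.dist_eq]
    rcases le_total s t with hst | hst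
    · rw [abs_sub_comm s t, abs_of_nonneg (sub_nonneg.2 hst)]
      exact key s t hst
    · rw [abs_sub_comm (g (p s)), abs_of_nonneg (sub_nonneg.2 hst)]
      exact key t s hst

/-- A function whose derivative has upper slope `c` at `t` is touched from above at `t` by a
quadratic polynomial in `r²` whose second derivative at `t` is any prescribed `c' > c`. -/
theorem eventually_le_quartic {k g : ℝ → ℝ} {t c c' : ℝ} (ht : 0 < t) (hcc : c < c')
    (hk : ∀ᶠ r in 𝓝 t, HasDerivAt k (g r) r)
    (hc : ∀ᶠ r in 𝓝 t, (g r - g t) * (r - t) ≤ c * (r - t) ^ 2) :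
    ∀ᶠ r in 𝓝 t, k r ≤ k t + g t / (2 * t) * (r ^ 2 - t ^ 2) +
      (c' - g t / t) / (8 * t ^ 2) * (r ^ 2 - t ^ 2) ^ 2 := by
  -- The coefficients make the first and second derivatives at `t` of the comparison polynomial
  -- equal to `g t` and `c'`.
  set b := g t / (2 * t) with hb
  set d := (c' - g t / t) / (8 * t ^ 2) with hd
  set D : ℝ → ℝ := fun r => k r - (k t + b * (r ^ 2 - t ^ 2) + d * (r ^ 2 - t ^ 2) ^ 2) with hD
  have hbt : 2 * b * t = g t := by rw [hb]; field_simp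
  have hdt : 2 * b + 8 * d * t ^ 2 = c' := by rw [hb, hd]; field_simp; ring
  have hDd : ∀ᶠ r in 𝓝 t,
      HasDerivAt D (g r - (2 * b * r + 4 * d * r * (r ^ 2 - t ^ 2))) r := by
    filter_upwards [hk] with r hr
    have h1 : HasDerivAt (fun r : ℝ => r ^ 2 - t ^ 2) (2 * r) r := by
      simpa using (hasDerivAt_pow 2 r).sub_const (t ^ 2)
    have h2 := hr.sub (((h1.const_mul b).const_add (k t)).add ((h1.pow 2).const_mul d))
    refine h2.congr_deriv ?_
    simp
    ring
  -- The bracket is the difference quotient of the polynomial's derivative. It equals `c'` at `r =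
  -- t`, hence exceeds `c` nearby, which makes `D` increase before `t` and decrease after.
  have hbr : ∀ᶠ r in 𝓝 t, c < 2 * b + 4 * d * r * (r + t) := by
    have : Tendsto (fun r : ℝ => 2 * b + 4 * d * r * (r + t)) (𝓝 t)
        (𝓝 (2 * b + 4 * d * t * (t + t))) := by
      apply Continuous.tendsto; fun_prop
    refine this.eventually (lt_mem_nhds ?_)
    linarith
  have hall := (hDd.and (hc.and hbr))
  obtain ⟨η, hη, hball⟩ := Metric.eventually_nhds_iff.1 hall
  have hsign : ∀ r, |r - t| < η →
      (g r - (2 * b * r + 4 * d * r * (r ^ 2 - t ^ 2))) * (r - t) ≤ 0 := by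
    intro r hr
    obtain ⟨-, h1, h2⟩ := hball (y := r) (by simpa [Real.dist_eq] using hr)
    have e : (g r - (2 * b * r + 4 * d * r * (r ^ 2 - t ^ 2))) * (r - t) =
      (g r - g t) * (r - t) - (2 * b + 4 * d * r * (r + t)) * (r - t) ^ 2 := by
      rw [← hbt]; ring
    rw [e]
    nlinarith [sq_nonneg (r - t)]
  have hder : ∀ r, |r - t| < η →
      HasDerivAt D (g r - (2 * b * r + 4 * d * r * (r ^ 2 - t ^ 2))) r := fun r hr =>
    (hball (y := r) (by simpa [Real.dist_eq] using hr)).1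
  have habs : ∀ r ∈ Ioo (t - η) (t + η), |r - t| < η := fun r hr => by
    rw [abs_lt]; constructor <;> linarith [hr.1, hr.2]
  have hmax : IsLocalMax D t := by
    refine isLocalMax_of_deriv_Ioo (a := t - η) (c := t + η) (by linarith) (by linarith)
      (hder t (by simpa using hη)).continuousAt
      (fun r hr => (hder r (habs r ⟨hr.1, by linarith [hr.2]⟩)).differentiableAt.differentiableWithinAt)
      (fun r hr => (hder r (habs r ⟨by linarith [hr.1], hr.2⟩)).differentiableAt.differentiableWithinAt)
      (fun r hr => ?_) (fun r hr => ?_)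
    · have h := habs r ⟨hr.1, by linarith [hr.2]⟩
      rw [(hder r h).deriv]
      exact nonneg_of_mul_nonpos_left (hsign r h) (by linarith [hr.2])
    · have h := habs r ⟨by linarith [hr.1], hr.2⟩
      rw [(hder r h).deriv]
      exact nonpos_of_mul_nonpos_left (hsign r h) (by linarith [hr.1])
  filter_upwards [hmax] with r hr
  simp only [hD] at hr
  simp at hr
  linarith


/-! ### Characteristic functions: monotonicity, semicontinuity and integrals. -/

section Characteristic

variable {n : ℕ} {F : Set (Matrix (Fin n) (Fin n) ℝ)}

theorem dotProduct_self_pos {e : Fin n → ℝ} (he : e ≠ 0) : 0 < e ⬝ᵥ e := by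
  have h : 0 ≤ e ⬝ᵥ e := Finset.sum_nonneg fun i _ => mul_self_nonneg (e i)
  exact h.lt_of_ne fun h0 => he (dotProduct_self_eq_zero.1 h0.symm)

theorem posSemidef_projLine (e : Fin n → ℝ) : (projLine e).PosSemidef := by
  have h : (Matrix.vecMulVec e e).PosSemidef := by
    simpa using Matrix.posSemidef_vecMulVec_self_star e
  exact h.smul (inv_nonneg.2 (Finset.sum_nonneg fun i _ => mul_self_nonneg (e i)))

theorem posSemidef_projPerp {e : Fin n → ℝ} (he : e ≠ 0) : (projPerp e).PosSemidef := by
  refine Matrix.PosSemidef.of_dotProduct_mulVec_nonneg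
    (Matrix.isHermitian_one.sub (posSemidef_projLine e).1) fun v => ?_
  have hpos := dotProduct_self_pos he
  have hcs : (e ⬝ᵥ v) ^ 2 ≤ (e ⬝ᵥ e) * (v ⬝ᵥ v) := by
    have := Finset.sum_mul_sq_le_sq_mul_sq Finset.univ e v
    simpa [dotProduct, sq] using this
  have hq : star v ⬝ᵥ (projPerp e).mulVec v = v ⬝ᵥ v - (e ⬝ᵥ e)⁻¹ * (e ⬝ᵥ v) ^ 2 := by
    rw [projPerp, projLine, star_trivial, Matrix.sub_mulVec, Matrix.one_mulVec, dotProduct_sub,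
      Matrix.smul_mulVec, Matrix.vecMulVec_mulVec, dotProduct_smul]
    simp [dotProduct_comm v e]
    left; ring
  rw [hq, sub_nonneg, inv_mul_le_iff₀ hpos]
  exact hcs

theorem projLine_ne_zero {e : Fin n → ℝ} (he : e ≠ 0) : projLine e ≠ 0 := by
  obtain ⟨i, hi⟩ := Function.ne_iff.1 he
  intro h
  have := congrFun (congrFun h i) i
  simp [projLine, Matrix.vecMulVec_apply, (dotProduct_self_pos he).ne'] at this
  exact hi this

theorem exists_ne_zero_vec (hn : 1 ≤ n) : ∃ e : Fin n → ℝ, e ≠ 0 :=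
  ⟨fun _ => 1, fun h => one_ne_zero (congrFun h ⟨0, hn⟩)⟩

theorem IsBorderline.zero_mem (hb : IsBorderline F) : (0 : Matrix (Fin n) (Fin n) ℝ) ∈ F := by
  have : (0 : Matrix (Fin n) (Fin n) ℝ) ∈ F ∩ {A | (-A).PosSemidef} := by
    rw [show F ∩ {A | (-A).PosSemidef} = {0} from hb]; rfl
  exact this.1

theorem IsBorderline.neg_projLine_notMem (hb : IsBorderline F) {e : Fin n → ℝ} (he : e ≠ 0)
    {μ : ℝ} (hμ : 0 < μ) : (0 : ℝ) • projPerp e - μ • projLine e ∉ F := by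
  intro hmem
  have h0 : (0 : ℝ) • projPerp e - μ • projLine e ∈ F ∩ {A | (-A).PosSemidef} := by
    refine ⟨hmem, ?_⟩
    simpa using (posSemidef_projLine e).smul hμ.le
  rw [show F ∩ {A | (-A).PosSemidef} = {0} from hb] at h0
  have h1 : μ • projLine e = 0 := by simpa using h0
  exact projLine_ne_zero he ((smul_eq_zero.1 h1).resolve_left hμ.ne')

theorem IsSubequation.mem_of_le (hF : IsSubequation F) {e : Fin n → ℝ} (he : e ≠ 0)
    {l l' μ μ' : ℝ} (hl : l ≤ l') (hμ : μ' ≤ μ) (h : l • projPerp e - μ • projLine e ∈ F) :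
    l' • projPerp e - μ' • projLine e ∈ F := by
  have h1 := hF.positivity _ h _ (((posSemidef_projPerp he).smul (sub_nonneg.2 hl)).add
    ((posSemidef_projLine e).smul (sub_nonneg.2 hμ)))
  convert h1 using 1
  module

theorem le_upperChar {e : Fin n → ℝ} (he : e ≠ 0) {l μ : ℝ}
    (h : l • projPerp e - μ • projLine e ∈ F) : (μ : EReal) ≤ upperChar F l :=
  le_sSup ⟨μ, ⟨e, he, h⟩, rfl⟩

theorem upperChar_mono (hF : IsSubequation F) : Monotone (upperChar F) := by
  intro l l' hl
  refine sSup_le ?_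
  rintro _ ⟨μ, ⟨e, he, h⟩, rfl⟩
  exact le_upperChar he (hF.mem_of_le he hl le_rfl h)

theorem le_lowerChar {l μ : ℝ}
    (h : ∀ e : Fin n → ℝ, e ≠ 0 → l • projPerp e - μ • projLine e ∈ F) :
    (μ : EReal) ≤ lowerChar F l :=
  le_sSup ⟨μ, h, rfl⟩

theorem lowerChar_mono (hF : IsSubequation F) : Monotone (lowerChar F) := by
  intro l l' hl
  refine sSup_le ?_
  rintro _ ⟨μ, h, rfl⟩
  exact le_lowerChar fun e he => hF.mem_of_le he hl le_rfl (h e he)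

theorem mem_of_lt_lowerChar (hF : IsSubequation F) {l μ : ℝ} (h : (μ : EReal) < lowerChar F l)
    (e : Fin n → ℝ) (he : e ≠ 0) : l • projPerp e - μ • projLine e ∈ F := by
  obtain ⟨_, ⟨ν, hν, rfl⟩, hlt⟩ := lt_sSup_iff.1 h
  exact hF.mem_of_le he le_rfl (EReal.coe_lt_coe_iff.1 hlt).le (hν e he)

/-- Closedness of `F` makes a finite supremum attained. -/
theorem mem_of_lowerChar_eq (hF : IsSubequation F) {l μ : ℝ} (h : lowerChar F l = μ)
    (e : Fin n → ℝ) (he : e ≠ 0) : l • projPerp e - μ • projLine e ∈ F := by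
  have ht : Tendsto (fun ν : ℝ => l • projPerp e - ν • projLine e) (𝓝[<] μ)
      (𝓝 (l • projPerp e - μ • projLine e)) := by
    refine (Continuous.tendsto ?_ μ).mono_left nhdsWithin_le_nhds
    fun_prop
  refine hF.isClosed.mem_of_tendsto ht ?_
  filter_upwards [self_mem_nhdsWithin] with ν hν
  exact mem_of_lt_lowerChar hF (by rw [h]; exact EReal.coe_lt_coe_iff.2 hν) e he

/-- Upper semicontinuity: some direction fails at `(l, μ)`, and as the complement of `F` is open the
same direction fails for nearby `l'`. -/
theorem eventually_lowerChar_le (hF : IsSubequation F) {l μ : ℝ} (h : lowerChar F l < μ) :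
    ∀ᶠ l' in 𝓝 l, lowerChar F l' ≤ μ := by
  have h1 : ¬ ∀ e : Fin n → ℝ, e ≠ 0 → l • projPerp e - μ • projLine e ∈ F := fun hall =>
    absurd (le_lowerChar hall) (not_le.2 h)
  push Not at h1
  obtain ⟨e, he, hne⟩ := h1
  have hopen : ∀ᶠ l' in 𝓝 l, l' • projPerp e - μ • projLine e ∈ Fᶜ := by
    have hc : Continuous fun l' : ℝ => l' • projPerp e - μ • projLine e := by fun_prop
    exact hc.continuousAt.eventually (hF.isClosed.isOpen_compl.mem_nhds hne)
  filter_upwards [hopen] with l' hl'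
  refine sSup_le ?_
  rintro _ ⟨ν, hν, rfl⟩
  by_contra! hlt
  exact hl' (hF.mem_of_le he le_rfl (EReal.coe_lt_coe_iff.1 hlt).le (hν e he))

theorem lowerChar_zero (hn : 1 ≤ n) (hb : IsBorderline F) : lowerChar F 0 = 0 := by
  refine le_antisymm (sSup_le ?_) (le_lowerChar (μ := 0) fun e he => by simpa using hb.zero_mem)
  rintro _ ⟨μ, hμ, rfl⟩
  obtain ⟨e, he⟩ := exists_ne_zero_vec hn
  by_contra! h
  exact hb.neg_projLine_notMem he (by exact_mod_cast h) (hμ e he)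

theorem IsInvariant.upperChar_eq_lowerChar (hn : 1 ≤ n) (hI : IsInvariant F) :
    upperChar F = lowerChar F := by
  funext l
  unfold upperChar lowerChar
  congr 2
  ext μ
  constructor
  · rintro ⟨e, he, h⟩ e' he'
    have := hI l (-μ) ⟨e, he, by simpa [sub_eq_add_neg] using h⟩ e' he'
    simpa [sub_eq_add_neg] using this
  · intro h
    obtain ⟨e, he⟩ := exists_ne_zero_vec hn
    exact ⟨e, he, h e he⟩

theorem recipIntegral_eq_lintegral {f : ℝ → EReal} {φ : ℝ → ℝ} {b : ℝ}
    (hf : ∀ y ∈ Ioc 0 b, f y = φ y) (hφ : ∀ y ∈ Ioc 0 b, 0 < φ y) :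
    recipIntegral f b = ∫⁻ y in Ioc 0 b, ENNReal.ofReal (φ y)⁻¹ := by
  refine setLIntegral_congr_fun measurableSet_Ioc fun y hy => ?_
  rw [hf y hy, ENNReal.ofReal_inv_of_pos (hφ y hy), EReal.toENNReal_of_ne_top (by simp)]
  simp

theorem intervalIntegrable_inv_of_monotoneOn {f : ℝ → ℝ} {a b : ℝ} (hab : a ≤ b)
    (hf : MonotoneOn f (Icc a b)) (hpos : ∀ y ∈ Icc a b, 0 < f y) :
    IntervalIntegrable (fun y => (f y)⁻¹) volume a b := by
  refine AntitoneOn.intervalIntegrable ?_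
  rw [uIcc_of_le hab]
  exact fun x hx y hy hxy => inv_anti₀ (hpos x hx) (hf hx hy hxy)

/-- Borderline gives value zero at zero, and semicontinuity then gives finiteness nearby, so near
zero the lower function can be handled as a real function. -/
theorem exists_real_lowerChar (hn : 1 ≤ n) (hF : IsSubequation F) (hb : IsBorderline F)
    (h : IntegralConvergesAtZero (lowerChar F)) :
    ∃ (b : ℝ) (f : ℝ → ℝ), 0 < b ∧ MonotoneOn f (Icc 0 b) ∧ f 0 = 0 ∧
      (∀ y ∈ Ioc 0 b, 0 < f y) ∧ IntervalIntegrable (fun y => (f y)⁻¹) volume 0 b ∧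
      (∀ l ∈ Icc 0 b, ∀ e : Fin n → ℝ, e ≠ 0 → l • projPerp e - f l • projLine e ∈ F) ∧
      ∀ l ∈ Icc 0 b, ∀ δ > 0, ∀ᶠ l' in 𝓝 l, l' ∈ Icc 0 b → f l' ≤ f l + δ := by
  obtain ⟨ε, hε, hint⟩ := h
  have h1 : ∀ᶠ l in 𝓝 (0 : ℝ), lowerChar F l ≤ (1 : ℝ) :=
    eventually_lowerChar_le hF (by rw [lowerChar_zero hn hb]; exact_mod_cast one_pos)
  obtain ⟨η, hη, hball⟩ := Metric.eventually_nhds_iff.1 h1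
  set b := min ε (η / 2) with hbdef
  have hbpos : 0 < b := lt_min hε (by linarith)
  set f : ℝ → ℝ := fun l => (lowerChar F l).toReal with hf
  have hcoe : ∀ l ∈ Icc 0 b, lowerChar F l = f l := by
    intro l hl
    have h2 : lowerChar F l ≤ (1 : ℝ) := hball (by
      rw [Real.dist_eq, sub_zero, abs_of_nonneg hl.1]
      linarith [hl.2, min_le_right ε (η / 2)])
    have h3 : (0 : EReal) ≤ lowerChar F l := by
      rw [← lowerChar_zero hn hb]; exact lowerChar_mono hF hl.1
    refine (EReal.coe_toReal ?_ ?_).symm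
    · exact (h2.trans_lt (EReal.coe_lt_top 1)).ne
    · exact (EReal.bot_lt_zero.trans_le h3).ne'
  have hf0 : f 0 = 0 := by simp [hf, lowerChar_zero hn hb]
  have hmono : MonotoneOn f (Icc 0 b) := by
    intro x hx y hy hxy
    have := lowerChar_mono hF hxy
    rw [hcoe x hx, hcoe y hy] at this
    exact EReal.coe_le_coe_iff.1 this
  have hle : recipIntegral (lowerChar F) b < ⊤ :=
    (lintegral_mono_set (Ioc_subset_Ioc_right (min_le_left _ _))).trans_lt hint
  -- A zero at `y` would, by monotonicity, make the integrand infinite on all of `(0, y]`.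
  have hpos : ∀ y ∈ Ioc 0 b, 0 < f y := by
    intro y hy
    by_contra! hy0
    have htop : (⊤ : ENNReal) ≤ recipIntegral (lowerChar F) b := by
      calc (⊤ : ENNReal) = ∫⁻ _ in Ioc 0 y, ⊤ := by
            rw [setLIntegral_const, Real.volume_Ioc, ENNReal.top_mul]
            simpa using hy.1
        _ ≤ ∫⁻ z in Ioc 0 y, ((lowerChar F z).toENNReal)⁻¹ := by
            refine setLIntegral_mono' measurableSet_Ioc fun z hz => ?_
            have hz' : lowerChar F z ≤ 0 := by
              refine (lowerChar_mono hF hz.2).trans ?_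
              rw [hcoe y ⟨hy.1.le, hy.2⟩]
              exact_mod_cast hy0
            rw [EReal.toENNReal_of_nonpos hz', ENNReal.inv_zero]
        _ ≤ _ := lintegral_mono_set (Ioc_subset_Ioc_right hy.2)
    exact absurd hle (not_lt.2 htop)
  refine ⟨b, f, hbpos, hmono, hf0, hpos, ?_, fun l hl => mem_of_lowerChar_eq hF (hcoe l hl), ?_⟩
  · rw [intervalIntegrable_iff_integrableOn_Ioc_of_le hbpos.le]
    have hanti : AntitoneOn (fun y => (f y)⁻¹) (Ioc 0 b) := fun x hx y hy hxy =>
      inv_anti₀ (hpos x hx) (hmono (Ioc_subset_Icc_self hx) (Ioc_subset_Icc_self hy) hxy)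
    refine ⟨(aemeasurable_restrict_of_antitoneOn measurableSet_Ioc hanti).aestronglyMeasurable, ?_⟩
    rw [hasFiniteIntegral_iff_ofReal]
    · rwa [← recipIntegral_eq_lintegral (fun y hy => hcoe y (Ioc_subset_Icc_self hy)) hpos]
    · filter_upwards [ae_restrict_mem measurableSet_Ioc] with y hy
      exact inv_nonneg.2 (hpos y hy).le
  · intro l hl δ hδ
    have h2 : lowerChar F l < ((f l + δ : ℝ) : EReal) := by
      rw [hcoe l hl]; exact EReal.coe_lt_coe_iff.2 (by linarith)
    filter_upwards [eventually_lowerChar_le hF h2] with l' hl' hmem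
    rw [hcoe l' hmem] at hl'
    exact EReal.coe_le_coe_iff.1 hl'

/-- Divergence excludes the value `⊤` on all of `(0, 1]`, where the integral would be zero.
Monotonicity then leaves two cases: nonpositive at some `b > 0`, or finite and positive near zero
with truncated integrals unbounded. -/
theorem exists_real_upperChar (hF : IsSubequation F) (h : IntegralDivergesAtZero (upperChar F)) :
    (∃ b > 0, upperChar F b ≤ 0) ∨
    ∃ (b : ℝ) (f : ℝ → ℝ), 0 < b ∧ MonotoneOn f (Ioc 0 b) ∧ (∀ y ∈ Ioc 0 b, 0 < f y) ∧
      (∀ l ∈ Ioc 0 b, upperChar F l = f l) ∧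
      ∀ b' ∈ Ioc 0 b, ∀ L : ℝ, ∃ a ∈ Ioo 0 b', L ≤ ∫ y in a..b', (f y)⁻¹ := by
  by_cases h0 : ∃ b > 0, upperChar F b ≤ 0
  · exact Or.inl h0
  right
  push Not at h0
  have hfin : ∃ b > 0, upperChar F b ≠ ⊤ := by
    by_contra! htop
    have : recipIntegral (upperChar F) 1 = 0 := by
      unfold recipIntegral
      rw [setLIntegral_congr_fun measurableSet_Ioc (g := fun _ => 0)
        fun y hy => by simp [htop y hy.1]]
      simp
    rw [h 1 one_pos] at this
    exact ENNReal.top_ne_zero this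
  obtain ⟨b, hb, hbtop⟩ := hfin
  set f : ℝ → ℝ := fun l => (upperChar F l).toReal with hf
  have hcoe : ∀ l ∈ Ioc 0 b, upperChar F l = f l := fun l hl =>
    (EReal.coe_toReal ((upperChar_mono hF hl.2).trans_lt hbtop.lt_top).ne
      (EReal.bot_lt_zero.trans (h0 l hl.1)).ne').symm
  have hmono : MonotoneOn f (Ioc 0 b) := by
    intro x hx y hy hxy
    have := upperChar_mono hF hxy
    rw [hcoe x hx, hcoe y hy] at this
    exact EReal.coe_le_coe_iff.1 this
  have hpos : ∀ y ∈ Ioc 0 b, 0 < f y := by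
    intro y hy
    have := h0 y hy.1
    rw [hcoe y hy] at this
    exact_mod_cast this
  refine ⟨b, f, hb, hmono, hpos, hcoe, fun b' hb' L => ?_⟩
  by_contra! hL
  have hsub : Ioc 0 b' ⊆ Ioc 0 b := Ioc_subset_Ioc_right hb'.2
  have hint : ∀ a ∈ Ioo 0 b', IntegrableOn (fun y => (f y)⁻¹) (Ioc a b') := fun a ha => by
    have hs : Icc a b' ⊆ Ioc 0 b := fun y hy => ⟨ha.1.trans_le hy.1, hy.2.trans hb'.2⟩
    exact (intervalIntegrable_iff_integrableOn_Ioc_of_le ha.2.le).1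
      (intervalIntegrable_inv_of_monotoneOn ha.2.le (hmono.mono hs) fun y hy => hpos y (hs hy))
  -- The shift by `2` keeps even the first point strictly below `b'`.
  have hseq : ∀ i : ℕ, b' / ((i : ℝ) + 2) ∈ Ioo 0 b' := fun i => by
    have : (0 : ℝ) ≤ i := Nat.cast_nonneg i
    refine ⟨div_pos hb'.1 (by linarith), ?_⟩
    rw [div_lt_iff₀ (by linarith)]
    nlinarith [hb'.1]
  have hI : IntegrableOn (fun y => (f y)⁻¹) (Ioc 0 b') := by
    refine integrableOn_Ioc_of_intervalIntegral_norm_bounded_left (I := L) (l := atTop)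
      (a := fun i : ℕ => b' / ((i : ℝ) + 2)) (fun i => hint _ (hseq i)) ?_ (.of_forall fun i => ?_)
    · exact tendsto_const_nhds.div_atTop
        (tendsto_atTop_add_const_right _ _ tendsto_natCast_atTop_atTop)
    · refine le_of_eq_of_le ?_ (hL _ (hseq i)).le
      rw [intervalIntegral.integral_of_le (hseq i).2.le]
      refine setIntegral_congr_fun measurableSet_Ioc fun y hy => ?_
      have : 0 < f y := hpos y (hsub ⟨(hseq i).1.trans hy.1, hy.2⟩)
      simp [abs_of_pos this]
  have hlt := (hasFiniteIntegral_iff_ofReal (by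
    filter_upwards [ae_restrict_mem measurableSet_Ioc] with y hy
    exact inv_nonneg.2 (hpos y (hsub hy)).le)).1 hI.2
  rw [← recipIntegral_eq_lintegral (fun y hy => hcoe y (hsub hy)) fun y hy => hpos y (hsub hy),
    h b' hb'.1] at hlt
  exact lt_irrefl _ hlt

end Characteristic


/-! ### Divergent integral: barrier, Hopf lemma, strong maximum principle. -/

section StrongMaximum

variable {n : ℕ} {F : Set (Matrix (Fin n) (Fin n) ℝ)}

/-- The profile of a radial barrier on the annulus of radii `R / 2` and `3 * R / 2`. -/
theorem exists_barrier (hF : IsSubequation F) (hdiv : IntegralDivergesAtZero (upperChar F))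
    {R δ : ℝ} (hR : 0 < R) (hδ : 0 < δ) :
    ∃ k g : ℝ → ℝ, (∀ r, HasDerivAt k (g r) r) ∧ k R = 0 ∧ -δ < k (R / 2) ∧ 0 < k (3 * R / 2) ∧
      ∀ t ∈ Ioo (R / 2) (3 * R / 2), ∃ μ : ℝ, upperChar F (g t / t) ≤ μ ∧
        ∀ᶠ r in 𝓝 t, (g r - g t) * (r - t) ≤ -μ * (r - t) ^ 2 := by
  rcases exists_real_upperChar hF hdiv with ⟨b, hb, hb0⟩ | ⟨b, f, hb, hmono, hpos, hcoe, hex⟩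
  -- A linear profile suffices: `η / t ≤ b` for `t > R / 2`, and the drop `η R / 2` is below `δ`.
  · set η := min (b * R / 2) (δ / R) with hη
    have hηpos : 0 < η := lt_min (by positivity) (by positivity)
    have hηδ : η * R ≤ δ := by
      rw [← le_div_iff₀ hR]; exact min_le_right _ _
    have hηb : η ≤ b * R / 2 := min_le_left _ _
    refine ⟨fun r => η * (r - R), fun _ => η, fun r => ?_, by simp, ?_, ?_, fun t ht => ⟨0, ?_, ?_⟩⟩
    · simpa using ((hasDerivAt_id r).sub_const R).const_mul η
    · simp only; nlinarith
    · have : 0 < η * R := by positivity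
      simp only; nlinarith
    · refine (upperChar_mono hF ?_).trans (by exact_mod_cast hb0)
      rw [div_le_iff₀ (by linarith [ht.1])]
      nlinarith [ht.1]
    · exact .of_forall fun r => by simp
  -- After rescaling by `κ`, the annulus of width `R = 4κ` takes flow time `4`, hence the `4`
  -- required of the integral below. As `t > 2κ`, a factor of two is left between `G t / t` and `G t
  -- / κ`.
  · set κ := R / 4 with hκ
    have hκ0 : 0 < κ := by positivity
    set b' := min b (δ / (κ * R)) with hb'
    have hb'pos : 0 < b' := lt_min hb (by positivity)
    have hbδ : b' * (κ * R) ≤ δ := by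
      rw [← le_div_iff₀ (by positivity)]; exact min_le_right _ _
    obtain ⟨a, ha, haT⟩ := hex b' ⟨hb'pos, min_le_left _ _⟩ 4
    have hs : Icc a b' ⊆ Ioc 0 b := fun y hy => ⟨ha.1.trans_le hy.1, hy.2.trans (min_le_left _ _)⟩
    obtain ⟨g, hg, -, -, hdec, hflow, hlip⟩ := exists_decreasing_flow_real ha.2.le
      (hmono.mono hs) (fun y hy => hpos y (hs (Ioc_subset_Icc_self hy)))
      (hpos a (hs (left_mem_Icc.2 ha.2.le))).le
      (intervalIntegrable_inv_of_monotoneOn ha.2.le (hmono.mono hs) fun y hy => hpos y (hs hy))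
    set G : ℝ → ℝ := fun r => κ * g ((r - R / 2) / κ) with hG
    have hGc : Continuous G := by
      have := hlip.continuous
      fun_prop
    have hGpos : ∀ r, 0 < G r := fun r => mul_pos hκ0 (ha.1.trans_le (hg _).1)
    have hGle : ∀ r, G r ≤ κ * b' := fun r => mul_le_mul_of_nonneg_left (hg _).2 hκ0.le
    have hGflow : ∀ s t, R / 2 ≤ s → s ≤ t → t ≤ 3 * R / 2 →
        f (G t / κ) * (t - s) ≤ G s - G t := by
      intro s t hs hst ht
      have h1 := hflow ((s - R / 2) / κ) ((t - R / 2) / κ) (div_nonneg (by linarith) hκ0.le)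
        (by gcongr) (le_trans (by rw [div_le_iff₀ hκ0]; linarith) haT)
      have h2 := mul_le_mul_of_nonneg_left h1 hκ0.le
      have e1 : G t / κ = g ((t - R / 2) / κ) := by simp only [hG]; field_simp
      have e2 : κ * (f (g ((t - R / 2) / κ)) * ((t - R / 2) / κ - (s - R / 2) / κ)) =
          f (g ((t - R / 2) / κ)) * (t - s) := by field_simp; ring
      rw [e1, ← e2]
      simp only [hG]
      linarith
    have hk : ∀ r, HasDerivAt (fun r => ∫ y in R..r, G y) (G r) r := fun r =>
      (hGc.integral_hasStrictDerivAt R r).hasDerivAt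
    refine ⟨fun r => ∫ y in R..r, G y, G, hk, by simp, ?_, ?_, fun t ht => ?_⟩
    · simp only
      rw [intervalIntegral.integral_symm, neg_lt_neg_iff]
      calc ∫ y in (R / 2)..R, G y ≤ ∫ y in (R / 2)..R, κ * b' :=
            intervalIntegral.integral_mono_on (by linarith) (hGc.intervalIntegrable _ _) (by simp)
              fun y _ => hGle y
        _ = (b' * (κ * R)) / 2 := by rw [intervalIntegral.integral_const, smul_eq_mul]; ring
        _ < δ := by linarith
    · exact intervalIntegral.intervalIntegral_pos_of_pos (hGc.intervalIntegrable _ _) hGpos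
        (by linarith)
    · have ht0 : 0 < t := by linarith [ht.1]
      have hle : G t / t ≤ (G t / 2) / κ := by
        rw [div_div, div_le_div_iff_of_pos_left (hGpos t) ht0 (by positivity)]
        linarith [ht.1]
      have hmem : ∀ r, G r / κ ∈ Ioc 0 b := fun r =>
        ⟨div_pos (hGpos r) hκ0, by
          rw [div_le_iff₀ hκ0, mul_comm]
          exact (hGle r).trans (mul_le_mul_of_nonneg_left (min_le_left _ _) hκ0.le)⟩
      have hlt : G t / t ≤ G t / κ := hle.trans (by
        have := hGpos t
        gcongr; linarith)
      have hmemt : G t / t ∈ Ioc 0 b := ⟨div_pos (hGpos t) ht0, hlt.trans (hmem t).2⟩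
      refine ⟨f (G t / t), (hcoe _ hmemt).le, ?_⟩
      -- The spare factor of two gives `G t / t ≤ G r / κ` also for `r` slightly beyond `t`, so no
      -- continuity of `f` is needed.
      have hev : ∀ᶠ r in 𝓝 t, G t / 2 < G r :=
        hGc.continuousAt.eventually (lt_mem_nhds (by linarith [hGpos t]))
      filter_upwards [hev, Ioo_mem_nhds ht.1 ht.2] with r hr hrI
      rcases le_total r t with hrt | hrt
      · have h1 := hGflow r t hrI.1.le hrt ht.2.le
        have h2 : f (G t / t) ≤ f (G t / κ) := hmono hmemt (hmem t) hlt
        have h3 := mul_le_mul_of_nonneg_right h2 (sub_nonneg.2 hrt)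
        nlinarith
      · have h1 := hGflow t r ht.1.le hrt hrI.2.le
        have h2 : f (G t / t) ≤ f (G r / κ) :=
          hmono hmemt (hmem r) (hle.trans (by gcongr))
        have h3 := mul_le_mul_of_nonneg_right h2 (sub_nonneg.2 hrt)
        nlinarith

/-- Hopf argument: `u` minus the barrier is negative on both boundary spheres of the annulus but
zero at `x₁`, so it has an interior maximum, where the barrier's Hessian would have to lie in `F`.
-/
theorem not_isMax_on_sphere (hF : IsSubequation F)
    (hdiv : IntegralDivergesAtZero (upperChar F)) {X : Set (EuclideanSpace ℝ (Fin n))}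
    {u : EuclideanSpace ℝ (Fin n) → EReal} (hu : IsSubharmonicOn F X u)
    {y x₁ : EuclideanSpace ℝ (Fin n)} {R M : ℝ} (hR : 0 < R)
    (hX : Metric.closedBall y (3 * R / 2) ⊆ X) (hM : ∀ x ∈ X, u x ≤ M)
    (hlt : ∀ x ∈ Metric.ball y R, u x < M) (hx₁ : ‖x₁ - y‖ = R) : u x₁ ≠ M := by
  intro hux₁
  have hballX : ∀ x, ‖x - y‖ ≤ 3 * R / 2 → x ∈ X := fun x hx => hX (by
    rwa [mem_closedBall_iff_norm])
  obtain ⟨δ, hδ, hδu⟩ : ∃ δ > 0, ∀ x, ‖x - y‖ = R / 2 → u x ≤ ((M - δ : ℝ) : EReal) := by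
    rcases (Metric.sphere y (R / 2)).eq_empty_or_nonempty with he | hne
    · refine ⟨1, one_pos, fun x hx => ?_⟩
      have : x ∈ Metric.sphere y (R / 2) := by rwa [mem_sphere_iff_norm]
      simp [he] at this
    · obtain ⟨z, hz, hmax⟩ := UpperSemicontinuousOn.exists_isMaxOn hne (isCompact_sphere y (R / 2))
        (hu.usc.mono fun x hx => hballX x (by rw [mem_sphere_iff_norm.1 hx]; linarith))
      have hzlt := hlt z (by
        rw [mem_ball_iff_norm, mem_sphere_iff_norm.1 hz]; linarith)
      obtain ⟨m, hm1, hm2⟩ := EReal.lt_iff_exists_real_btwn.1 hzlt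
      refine ⟨M - m, sub_pos.2 (EReal.coe_lt_coe_iff.1 hm2), fun x hx => ?_⟩
      rw [sub_sub_cancel]
      exact (hmax (mem_sphere_iff_norm.2 hx)).trans hm1.le
  obtain ⟨k, g, hk, hkR, hkin, hkout, hkμ⟩ := exists_barrier hF hdiv hR hδ
  -- On the outer sphere the quadratic correction costs `5 ε R² / 4`, which is `5/8` of `k (3R/2)`,
  -- so the barrier stays above `M` there.
  set ε := k (3 * R / 2) / (2 * R ^ 2) with hε
  have hε0 : 0 < ε := by positivity
  have hεR : ε * (2 * R ^ 2) = k (3 * R / 2) := by rw [hε]; field_simp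
  set κ : ℝ → ℝ := fun r => k r - ε * r ^ 2 with hκ
  set φ : EuclideanSpace ℝ (Fin n) → ℝ := fun x => M + κ ‖x - y‖ + ε * R ^ 2 with hφ
  have hκd : ∀ r, HasDerivAt κ (g r - 2 * ε * r) r := fun r => by
    refine ((hk r).sub ((hasDerivAt_pow 2 r).const_mul ε)).congr_deriv ?_
    simp; ring
  have hκc : Continuous κ := continuous_iff_continuousAt.2 fun r => (hκd r).continuousAt
  have hφc : Continuous φ := by fun_prop
  set A : Set (EuclideanSpace ℝ (Fin n)) := {x | ‖x - y‖ ∈ Icc (R / 2) (3 * R / 2)} with hA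
  have hAX : A ⊆ X := fun x hx => hballX x hx.2
  have hAc : IsCompact A := by
    refine (isCompact_closedBall y (3 * R / 2)).of_isClosed_subset ?_ fun x hx =>
      mem_closedBall_iff_norm.2 hx.2
    exact isClosed_Icc.preimage (by fun_prop : Continuous fun x => ‖x - y‖)
  have hx₁A : x₁ ∈ A := ⟨by rw [hx₁]; linarith, by rw [hx₁]; linarith⟩
  have husc : UpperSemicontinuousOn (fun x => u x + ((-φ x : ℝ) : EReal)) A := by
    refine UpperSemicontinuousOn.add' (hu.usc.mono hAX) ?_ fun x hx => ?_
    · exact ((continuous_coe_real_ereal.comp hφc.neg).upperSemicontinuous).upperSemicontinuousOn _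
    · exact EReal.continuousAt_add (Or.inr (EReal.coe_ne_bot _)) (Or.inr (EReal.coe_ne_top _))
  obtain ⟨z, hzA, hzmax⟩ := UpperSemicontinuousOn.exists_isMaxOn ⟨x₁, hx₁A⟩ hAc husc
  have hφx₁ : φ x₁ = M := by simp only [hφ, hκ, hx₁, hkR]; ring
  have hz0 : 0 ≤ u z + ((-φ z : ℝ) : EReal) := by
    refine le_trans (le_of_eq ?_) (hzmax hx₁A)
    simp only [hφx₁, hux₁]
    rw [← EReal.coe_add, add_neg_cancel, EReal.coe_zero]
  have hzbot : u z ≠ ⊥ := fun h => by rw [h, EReal.bot_add] at hz0; simp at hz0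
  obtain ⟨a, ha⟩ : ∃ a : ℝ, u z = a := ⟨(u z).toReal, (EReal.coe_toReal (hu.ne_top z (hAX hzA)) hzbot).symm⟩
  have haφ : φ z ≤ a := by
    rw [ha, ← EReal.coe_add] at hz0
    have : (0 : ℝ) ≤ a + -φ z := by exact_mod_cast hz0
    linarith
  have haM : a ≤ M := EReal.coe_le_coe_iff.1 (ha ▸ hM z (hAX hzA))
  set t := ‖z - y‖ with ht
  have htI : t ∈ Ioo (R / 2) (3 * R / 2) := by
    refine ⟨hzA.1.lt_of_ne fun h => ?_, hzA.2.lt_of_ne fun h => ?_⟩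
    · have h1 : a ≤ M - δ := EReal.coe_le_coe_iff.1 (ha ▸ hδu z h.symm)
      have h2 : φ z = M + (k (R / 2) - ε * (R / 2) ^ 2) + ε * R ^ 2 := by
        simp only [hφ, hκ]; rw [← h]
      nlinarith [mul_pos hε0 (pow_pos hR 2)]
    · change t = 3 * R / 2 at h
      have h2 : φ z = M + (k (3 * R / 2) - ε * (3 * R / 2) ^ 2) + ε * R ^ 2 := by
        simp only [hφ, hκ]; rw [← ht, h]
      nlinarith [mul_pos hε0 (pow_pos hR 2)]
  have ht0 : 0 < t := by linarith [htI.1]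
  obtain ⟨μ, hμ, hμev⟩ := hkμ t htI
  -- The correction lowers the slope of the derivative to `-μ - 2ε`; half of this gain buys the
  -- strict inequality for the quartic, the other half yields `μ + ε ≤ μ` at the end.
  have hquart := eventually_le_quartic (k := κ) (g := fun r => g r - 2 * ε * r) (c := -μ - 2 * ε)
    (c' := -μ - ε) ht0 (by linarith) (.of_forall hκd) (by
      filter_upwards [hμev] with r hr
      nlinarith)
  set b := (g t - 2 * ε * t) / (2 * t) with hb
  set d := (-μ - ε - (g t - 2 * ε * t) / t) / (8 * t ^ 2) with hd
  have hnorm : Continuous fun x : EuclideanSpace ℝ (Fin n) => ‖x - y‖ := by fun_prop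
  have htest := hu.test z (hAX hzA) (radialQuartic y t a b d)
    (contDiff_radialQuartic y t a b d).contDiffAt (by
      filter_upwards [hnorm.continuousAt.eventually hquart,
        hnorm.continuousAt.eventually (Ioo_mem_nhds htI.1 htI.2)] with x hx hxI
      have hxA : x ∈ A := Ioo_subset_Icc_self hxI
      have h1 : u x + ((-φ x : ℝ) : EReal) ≤ u z + ((-φ z : ℝ) : EReal) := hzmax hxA
      have h2 : u x ≤ ((a - φ z + φ x : ℝ) : EReal) := by
        have hxb := hu.ne_top x (hAX hxA)
        induction hv : u x using EReal.rec with
        | bot => exact bot_le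
        | top => exact absurd hv hxb
        | coe v =>
          rw [hv, ha, ← EReal.coe_add, ← EReal.coe_add, EReal.coe_le_coe_iff] at h1
          rw [EReal.coe_le_coe_iff]
          linarith
      refine h2.trans (EReal.coe_le_coe_iff.2 ?_)
      simp only [hφ, radialQuartic, ← ht]
      linarith) (by simp [radialQuartic, ha, ht])
  rw [hessian_radialQuartic y a b d ht.symm ht0] at htest
  have e1 : 2 * b = g t / t - 2 * ε := by rw [hb]; field_simp
  have e2 : 2 * b + 8 * d * t ^ 2 = -(μ + ε) := by rw [hb, hd]; field_simp; ring
  rw [e1] at e2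
  have hne : WithLp.ofLp (z - y) ≠ 0 := fun h => by
    have h0 : z - y = 0 := (WithLp.ofLp_eq_zero 2).1 h
    rw [ht, h0, norm_zero] at ht0
    exact lt_irrefl _ ht0
  rw [e1, e2, neg_smul, ← sub_eq_add_neg] at htest
  have h3 := (le_upperChar hne htest).trans ((upperChar_mono hF (by linarith)).trans hμ)
  have h4 : μ + ε ≤ μ := EReal.coe_le_coe_iff.1 h3
  linarith

/-- If `u` is not constant inside, connectedness gives an interior boundary point `z` of `{u < M}`.
A ball about a nearby point of that set, grown until it meets `{u = M}`, contradicts the Hopf lemma.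
Upper semicontinuity carries the constant to the closure. -/
theorem strongMaxPrinciple_of_divergent (hF : IsSubequation F)
    (hdiv : IntegralDivergesAtZero (upperChar F)) : StrongMaxPrinciple F := by
  rintro K u hK hconn huK hutop hu ⟨x₀, hx₀, hmax⟩
  set Ω := interior K with hΩ
  have hΩK : Ω ⊆ K := interior_subset
  have hΩo : IsOpen Ω := isOpen_interior
  have hall : ∀ x ∈ Ω, u x = u x₀ := by
    by_contra! hne
    obtain ⟨p, hp, hpne⟩ := hne
    have hplt : u p < u x₀ := (hmax p (hΩK hp)).lt_of_ne hpne
    obtain ⟨M, hM⟩ : ∃ M : ℝ, u x₀ = M :=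
      ⟨(u x₀).toReal, (EReal.coe_toReal (hutop _ (hΩK hx₀)) (bot_le.trans_lt hplt).ne').symm⟩
    set U : Set (EuclideanSpace ℝ (Fin n)) := {x | x ∈ Ω ∧ u x < M} with hU
    have hUo : IsOpen U := by
      obtain ⟨V, hV, hVe⟩ := upperSemicontinuousOn_iff_preimage_Iio.1 hu.usc M
      rw [show U = Ω ∩ V from hVe]
      exact hΩo.inter hV
    obtain ⟨z, hz⟩ : ∃ z, z ∈ closure U ∩ Ω ∧ z ∉ U := by
      by_contra! hc
      have hsub := hconn.isPreconnected.subset_of_closure_inter_subset hUo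
        ⟨p, hp, hp, hM ▸ hplt⟩ fun z hz => hc z hz
      exact (hsub hx₀).2.ne hM
    obtain ⟨⟨hzcl, hzΩ⟩, hzU⟩ := hz
    have hle : ∀ x ∈ Ω, u x ≤ M := fun x hx => hM ▸ hmax x (hΩK hx)
    have hzM : u z = M := le_antisymm (hle z hzΩ) (not_lt.1 fun h => hzU ⟨hzΩ, h⟩)
    obtain ⟨r, hr, hball⟩ := Metric.isOpen_iff.1 hΩo z hzΩ
    obtain ⟨y, hyU, hyz⟩ := Metric.mem_closure_iff.1 hzcl (r / 4) (by linarith)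
    have hcball : Metric.closedBall z (r / 2) ⊆ Ω :=
      (Metric.closedBall_subset_ball (by linarith)).trans hball
    -- With `y` within `r / 4` of `z`, the radius `R` is below `r / 4`: the ball of radius `R` about
    -- `y` lies where `E` sees every contact point, and the one of radius `3R/2` stays in `Ω`.
    set E := Metric.closedBall z (r / 2) ∩ u ⁻¹' Ici (M : EReal) with hE
    have hEc : IsCompact E :=
      (hu.usc.mono hcball).isCompact_inter_preimage_Ici (isCompact_closedBall z (r / 2)) _
    have hzE : z ∈ E := ⟨Metric.mem_closedBall_self (by linarith), hzM.ge⟩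
    obtain ⟨x₁, hx₁E, hx₁⟩ := hEc.exists_infDist_eq_dist ⟨z, hzE⟩ y
    set R := dist y x₁ with hR
    have hRr : R < r / 4 := by
      rw [← hx₁]
      exact (Metric.infDist_le_dist_of_mem hzE).trans_lt (by rwa [dist_comm])
    have hR0 : 0 < R := dist_pos.2 fun h => by
      have h1 : (M : EReal) ≤ u x₁ := hx₁E.2
      rw [← h] at h1
      exact absurd hyU.2 (not_lt.2 h1)
    have hdist : ∀ x s, dist x y ≤ s → dist x z < s + r / 4 := fun x s hx => by
      have := dist_triangle x y z
      rw [dist_comm] at hyz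
      linarith
    refine not_isMax_on_sphere hF hdiv hu (y := y) (x₁ := x₁) hR0 (fun x hx => hball ?_) hle
      (fun x hx => ?_) (by rw [← dist_eq_norm, dist_comm]) ?_
    · have := hdist x _ (Metric.mem_closedBall.1 hx)
      exact Metric.mem_ball.2 (by linarith)
    · have h1 := hdist x _ (Metric.mem_ball.1 hx).le
      have h2 : x ∈ Metric.closedBall z (r / 2) := Metric.mem_closedBall.2 (by linarith)
      by_contra! h
      have h3 : Metric.infDist y E ≤ dist y x := Metric.infDist_le_dist_of_mem ⟨h2, h⟩
      rw [hx₁, dist_comm y x] at h3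
      exact absurd (Metric.mem_ball.1 hx) (not_lt.2 h3)
    · exact le_antisymm (hle x₁ (hcball hx₁E.1)) hx₁E.2
  refine ⟨u x₀, fun x hx => ?_⟩
  have hxK : x ∈ K := closure_minimal hΩK hK.isClosed hx
  refine le_antisymm (hmax x hxK) ?_
  by_contra! hlt
  obtain ⟨V, hV, hVe⟩ := upperSemicontinuousOn_iff_preimage_Iio.1 huK (u x₀)
  have hxV : x ∈ V := (hVe.subset ⟨hxK, hlt⟩).2
  obtain ⟨w, hwV, hwΩ⟩ := mem_closure_iff.1 hx V hV hxV
  exact (hVe.superset ⟨hΩK hwΩ, hwV⟩).2.ne (hall w hwΩ)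

end StrongMaximum


/-! ### Convergent integral: a radial subharmonic function that becomes constant. -/

section Counterexample

variable {n : ℕ} {F : Set (Matrix (Fin n) (Fin n) ℝ)}

theorem IsSubharmonicOn.mono {X Y : Set (EuclideanSpace ℝ (Fin n))}
    {u : EuclideanSpace ℝ (Fin n) → EReal} (h : IsSubharmonicOn F X u) (hYX : Y ⊆ X) :
    IsSubharmonicOn F Y u :=
  ⟨h.usc.mono hYX, fun x hx => h.ne_top x (hYX hx), fun x hx => h.test x (hYX hx)⟩

/-- The derivative of the radial profile: a decreasing solution of `-g' ≤ f(g / t)` that vanishes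
from `t₀` on. -/
theorem exists_radial_profile_deriv {f : ℝ → ℝ} {b : ℝ} (hb : 0 < b)
    (hmono : MonotoneOn f (Icc 0 b)) (hf0 : f 0 = 0) (hpos : ∀ y ∈ Ioc 0 b, 0 < f y)
    (hint : IntervalIntegrable (fun y => (f y)⁻¹) volume 0 b)
    (husc : ∀ l ∈ Icc 0 b, ∀ δ > 0, ∀ᶠ l' in 𝓝 l, l' ∈ Icc 0 b → f l' ≤ f l + δ) :
    ∃ (g : ℝ → ℝ) (t₀ : ℝ) (C : NNReal), 1 < t₀ ∧ LipschitzWith C g ∧ (∀ t, 0 ≤ g t) ∧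
      (∀ t, t₀ ≤ t → g t = 0) ∧ (∀ t, 1 < t → t < t₀ → 0 < g t) ∧
      ∀ t, 1 < t → g t / t ∈ Icc 0 b ∧ ∀ δ > 0, ∀ᶠ r in 𝓝 t,
        (-g r - -g t) * (r - t) ≤ (f (g t / t) + δ) * (r - t) ^ 2 := by
  have hs : Icc 0 (b / 2) ⊆ Icc 0 b := Icc_subset_Icc_right (by linarith)
  have hint' : IntervalIntegrable (fun y => (f y)⁻¹) volume 0 (b / 2) :=
    hint.mono_set (by rw [uIcc_of_le hb.le, uIcc_of_le (by linarith)]; exact hs)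
  obtain ⟨g, hg, hgT, hgpos, hflow, -, hlip⟩ := exists_decreasing_flow_real
    (by linarith : 0 ≤ b / 2) (hmono.mono hs) (fun y hy => hpos y ⟨hy.1, by linarith [hy.2]⟩)
    hf0.ge hint'
  set T := ∫ y in (0 : ℝ)..(b / 2), (f y)⁻¹ with hT
  have hT0 : 0 < T := intervalIntegral.intervalIntegral_pos_of_pos_on hint'
    (fun y hy => inv_pos.2 (hpos y ⟨hy.1, by linarith [hy.2]⟩)) (by linarith)
  -- The flow is slowed by two and timed to die at `t₀`. The bound `t₀ ≤ 2` gives `G t / 2 ≤ G t /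
  -- t` while `G` is positive; `t₀ - 1 ≤ 2T` keeps the times nonnegative on `(1, t₀)`.
  set t₀ := 1 + min 1 (2 * T) with ht₀
  have ht₀1 : 1 < t₀ := by
    have : 0 < min 1 (2 * T) := lt_min one_pos (by linarith)
    linarith
  have ht₀2 : t₀ ≤ 2 := by linarith [min_le_left 1 (2 * T)]
  set G : ℝ → ℝ := fun t => 2 * g ((t - t₀) / 2 + T) with hG
  have hGlip : LipschitzWith (f (b / 2)).toNNReal G := by
    refine LipschitzWith.of_dist_le_mul fun s t => ?_
    have h1 := hlip.dist_le_mul ((s - t₀) / 2 + T) ((t - t₀) / 2 + T)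
    rw [Real.dist_eq, Real.dist_eq] at h1 ⊢
    have e1 : (s - t₀) / 2 + T - ((t - t₀) / 2 + T) = (s - t) / 2 := by ring
    rw [e1, abs_div, abs_two] at h1
    simp only [hG]
    rw [← mul_sub, abs_mul, abs_two]
    linarith
  have hG0 : ∀ t, 0 ≤ G t := fun t => mul_nonneg zero_le_two (hg _).1
  have hGb : ∀ t, G t ≤ b := fun t => by
    have := (hg ((t - t₀) / 2 + T)).2
    simp only [hG]; linarith
  have hGz : ∀ t, t₀ ≤ t → G t = 0 := fun t ht => by
    simp only [hG]
    rw [hgT _ (by linarith), mul_zero]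
  have hGflow : ∀ s t, s ≤ t → G s - G t ≤ f (G s / 2) * (t - s) := fun s t hst => by
    have h1 := (hflow ((s - t₀) / 2 + T) ((t - t₀) / 2 + T) (by linarith)).2
    have e1 : G s / 2 = g ((s - t₀) / 2 + T) := by simp only [hG]; ring
    rw [e1]
    simp only [hG]
    linarith
  have hhalf : ∀ t, G t / 2 ∈ Icc 0 b := fun t =>
    ⟨by linarith [hG0 t], by linarith [hGb t]⟩
  refine ⟨G, t₀, _, ht₀1, hGlip, hG0, hGz, fun t ht ht' => ?_, fun t ht => ?_⟩
  · have : 0 < g ((t - t₀) / 2 + T) :=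
      hgpos _ (by linarith [min_le_right 1 (2 * T)]) (by linarith)
    simp only [hG]; linarith
  · have ht0 : 0 < t := by linarith
    have hl : G t / t ∈ Icc 0 b := ⟨div_nonneg (hG0 t) ht0.le, by
      rw [div_le_iff₀ ht0]
      nlinarith [hGb t]⟩
    have hle : f (G t / 2) ≤ f (G t / t) := by
      refine hmono (hhalf t) hl ?_
      rcases le_total t₀ t with h | h
      · simp [hGz t h]
      · exact div_le_div_of_nonneg_left (hG0 t) ht0 (h.trans ht₀2)
    refine ⟨hl, fun δ hδ => ?_⟩
    have hcont : ContinuousAt (fun r => G r / 2) t := (hGlip.continuous.div_const 2).continuousAt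
    -- For `r < t` the flow bound involves `f` at the larger height `G r / 2`; semicontinuity
    -- compares it with `G t / 2` at the cost of `δ`.
    filter_upwards [hcont.eventually (husc _ (hhalf t) δ hδ)] with r hr
    have hr' := hr (hhalf r)
    rcases le_total r t with h | h
    · have h1 := hGflow r t h
      have h2 : f (G r / 2) * (t - r) ≤ (f (G t / t) + δ) * (t - r) :=
        mul_le_mul_of_nonneg_right (by linarith) (sub_nonneg.2 h)
      nlinarith
    · have h1 := hGflow t r h
      have h2 : f (G t / 2) * (r - t) ≤ (f (G t / t) + δ) * (r - t) :=
        mul_le_mul_of_nonneg_right (by linarith) (sub_nonneg.2 h)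
      nlinarith

theorem isSubharmonicOn_radial (hF : IsSubequation F) {f ψ g : ℝ → ℝ} {X : Set ℝ}
    (hX : ∀ t ∈ X, 0 < t) (hψ : ∀ t, HasDerivAt ψ (g t) t)
    (hmem : ∀ t ∈ X, ∀ e : Fin n → ℝ, e ≠ 0 →
      (g t / t) • projPerp e - f (g t / t) • projLine e ∈ F)
    (hslope : ∀ t ∈ X, ∀ δ > 0, ∀ᶠ r in 𝓝 t,
        (-g r - -g t) * (r - t) ≤ (f (g t / t) + δ) * (r - t) ^ 2) :
    IsSubharmonicOn F {x : EuclideanSpace ℝ (Fin n) | ‖x‖ ∈ X}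
      (fun x => ((ψ ‖x‖ : ℝ) : EReal)) := by
  have hψc : Continuous ψ := continuous_iff_continuousAt.2 fun r => (hψ r).continuousAt
  refine ⟨?_, fun x _ => EReal.coe_ne_top _, fun x hx φ hφ hle heq => ?_⟩
  · exact ((continuous_coe_real_ereal.comp (hψc.comp continuous_norm)).upperSemicontinuous)
      |>.upperSemicontinuousOn _
  set t := ‖x‖ with ht
  have ht0 : 0 < t := hX t hx
  set e : Fin n → ℝ := WithLp.ofLp (x - 0) with he
  have hne : e ≠ 0 := fun h => by
    have h0 : x - 0 = 0 := (WithLp.ofLp_eq_zero 2).1 h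
    rw [sub_zero] at h0
    rw [ht, h0, norm_zero] at ht0
    exact lt_irrefl _ ht0
  -- A radial polynomial with second radial derivative `-(f + 2δ)` touches `ψ` from below, hence
  -- also `φ`; so the Hessian of `φ` dominates that of the polynomial, which misses `F` by at most
  -- `2δ P_e`. Closedness removes `δ`.
  have hkey : ∀ δ : ℝ, 0 < δ → hessian φ x + (2 * δ) • projLine e ∈ F := by
    intro δ hδ
    have hquart := eventually_le_quartic (k := fun r => -ψ r) (g := fun r => -g r)
      (c := f (g t / t) + δ) (c' := f (g t / t) + 2 * δ) ht0 (by linarith)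
      (.of_forall fun r => (hψ r).neg) (hslope t hx δ hδ)
    set b := -g t / (2 * t) with hb
    set d := (f (g t / t) + 2 * δ - -g t / t) / (8 * t ^ 2) with hd
    have hW := contDiff_radialQuartic (0 : EuclideanSpace ℝ (Fin n)) t (-ψ t) b d
    have hmin : IsLocalMin (fun y => φ y + radialQuartic 0 t (-ψ t) b d y) x := by
      have hx0 : φ x + radialQuartic 0 t (-ψ t) b d x = 0 := by
        have : ψ t = φ x := EReal.coe_eq_coe_iff.1 heq
        simp [radialQuartic, ← ht, this]
      filter_upwards [continuous_norm.continuousAt.eventually hquart, hle] with y hy hy'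
      rw [hx0]
      have h1 : ψ ‖y‖ ≤ φ y := EReal.coe_le_coe_iff.1 hy'
      simp only [radialQuartic, sub_zero]
      linarith
    have hpsd := hessian_posSemidef_of_isLocalMin (hφ.add hW.contDiffAt) hmin
    rw [hessian_add hφ hW.contDiffAt,
      hessian_radialQuartic 0 (-ψ t) b d (by rw [sub_zero]) ht0] at hpsd
    have e1 : 2 * b = -(g t / t) := by rw [hb]; field_simp
    have e2 : 2 * b + 8 * d * t ^ 2 = f (g t / t) + 2 * δ := by
      rw [hb, hd]; field_simp; ring
    rw [e2, e1] at hpsd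
    have := hF.positivity _ (hmem t hx e hne) _ hpsd
    convert this using 1
    module
  have hlim : Tendsto (fun δ : ℝ => hessian φ x + (2 * δ) • projLine e) (𝓝[>] 0)
      (𝓝 (hessian φ x)) := by
    have hc : Continuous fun δ : ℝ => hessian φ x + (2 * δ) • projLine e := by fun_prop
    have := (hc.tendsto 0).mono_left (nhdsWithin_le_nhds (s := Ioi 0))
    simpa using this
  refine hF.isClosed.mem_of_tendsto hlim ?_
  filter_upwards [self_mem_nhdsWithin] with δ hδ using hkey δ hδ

theorem exists_radial_subharmonic (hn : 1 ≤ n) (hF : IsSubequation F) (hb : IsBorderline F)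
    (hconv : IntegralConvergesAtZero (lowerChar F)) :
    ∃ (ψ : ℝ → ℝ) (t₀ m : ℝ), 1 < t₀ ∧ DifferentiableOn ℝ ψ (Ioi 1) ∧
      (∃ C : NNReal, LipschitzOnWith C (deriv ψ) (Ioi 1)) ∧ MonotoneOn ψ (Ioi 1) ∧
      (∀ t : ℝ, 1 < t → t < t₀ → ψ t < m) ∧ (∀ t : ℝ, t₀ ≤ t → ψ t = m) ∧
      IsSubharmonicOn F {x : EuclideanSpace ℝ (Fin n) | 1 < ‖x‖}
        (fun x => ((ψ ‖x‖ : ℝ) : EReal)) := by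
  obtain ⟨b, f, hb0, hmono, hf0, hpos, hint, hmem, husc⟩ := exists_real_lowerChar hn hF hb hconv
  obtain ⟨g, t₀, C, ht₀, hlip, hg0, hgz, hgpos, hg⟩ :=
    exists_radial_profile_deriv hb0 hmono hf0 hpos hint husc
  have hgc := hlip.continuous
  have hψ : ∀ t, HasDerivAt (fun t => ∫ s in t₀..t, g s) (g t) t := fun t =>
    (hgc.integral_hasStrictDerivAt t₀ t).hasDerivAt
  have hd : deriv (fun t => ∫ s in t₀..t, g s) = g := funext fun t => (hψ t).deriv
  refine ⟨fun t => ∫ s in t₀..t, g s, t₀, 0, ht₀,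
    fun t _ => (hψ t).differentiableAt.differentiableWithinAt, ⟨C, ?_⟩, ?_, fun t ht ht' => ?_,
    fun t ht => ?_, ?_⟩
  · rw [hd]; exact hlip.lipschitzOnWith
  · refine (monotone_of_deriv_nonneg (fun t => (hψ t).differentiableAt) fun t => ?_).monotoneOn _
    rw [hd]; exact hg0 t
  · simp only
    rw [intervalIntegral.integral_symm, neg_lt_zero]
    exact intervalIntegral.intervalIntegral_pos_of_pos_on (hgc.intervalIntegrable _ _)
      (fun s hs => hgpos s (ht.trans hs.1) hs.2) ht'
  · simp only
    rw [intervalIntegral.integral_congr (g := fun _ => 0) fun s hs => ?_]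
    · simp
    · rw [uIcc_of_le ht] at hs
      exact hgz s hs.1
  · exact isSubharmonicOn_radial hF (X := Ioi 1) (fun t ht => one_pos.trans ht) hψ
      (fun t ht => hmem _ (hg t ht).1) (fun t ht => (hg t ht).2)

theorem not_strongMaxPrinciple_of_radial (hn : 1 ≤ n) {ψ : ℝ → ℝ} {t₀ m : ℝ} (ht₀ : 1 < t₀)
    (hlt : ∀ t : ℝ, 1 < t → t < t₀ → ψ t < m) (heq : ∀ t : ℝ, t₀ ≤ t → ψ t = m)
    (hψ : IsSubharmonicOn F {x : EuclideanSpace ℝ (Fin n) | 1 < ‖x‖}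
      (fun x => ((ψ ‖x‖ : ℝ) : EReal))) : ¬ StrongMaxPrinciple F := by
  intro hsmp
  set p : ℝ → EuclideanSpace ℝ (Fin n) := fun s => EuclideanSpace.single ⟨0, hn⟩ s with hp
  have hpnorm : ∀ s, 0 ≤ s → ‖p s‖ = s := fun s hs => by simp [hp, abs_of_nonneg hs]
  -- The ball stays in `|x| > 1`, its centre has norm `t₀` and value `m`, and the point of norm `t₀
  -- - r / 2` has a smaller value.
  set r := (t₀ - 1) / 2 with hr
  have hr0 : 0 < r := by rw [hr]; linarith
  have hint : interior (Metric.closedBall (p t₀) r) = Metric.ball (p t₀) r :=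
    interior_closedBall _ hr0.ne'
  have hsub : Metric.closedBall (p t₀) r ⊆ {x | 1 < ‖x‖} := fun x hx => by
    have h1 := mem_closedBall_iff_norm'.1 hx
    have h2 := norm_sub_norm_le (p t₀) x
    rw [hpnorm t₀ (by linarith)] at h2
    change 1 < ‖x‖
    linarith
  have hle : ∀ t, 1 < t → ψ t ≤ m := fun t ht =>
    (lt_or_ge t t₀).elim (fun h => (hlt t ht h).le) fun h => (heq t h).le
  obtain ⟨c, hc⟩ := hsmp (Metric.closedBall (p t₀) r) (fun x => ((ψ ‖x‖ : ℝ) : EReal))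
    (isCompact_closedBall _ _)
    (by rw [hint]; exact (convex_ball _ _).isConnected ⟨_, Metric.mem_ball_self hr0⟩)
    (hψ.usc.mono hsub) (fun x _ => EReal.coe_ne_top _)
    (hψ.mono (interior_subset.trans hsub))
    ⟨p t₀, by rw [hint]; exact Metric.mem_ball_self hr0, fun x hx => by
      rw [EReal.coe_le_coe_iff, hpnorm t₀ (by linarith), heq t₀ le_rfl]
      exact hle _ (hsub hx)⟩
  rw [hint] at hc
  have hq : p (t₀ - r / 2) ∈ Metric.ball (p t₀) r := by
    rw [Metric.mem_ball, PiLp.dist_single_same, Real.dist_eq,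
      show t₀ - r / 2 - t₀ = -(r / 2) by ring, abs_neg, abs_of_pos (by linarith)]
    linarith
  have h1 := (hc _ (subset_closure (Metric.mem_ball_self hr0))).trans (hc _ (subset_closure hq)).symm
  rw [EReal.coe_eq_coe_iff, hpnorm t₀ (by linarith), hpnorm _ (by linarith), heq t₀ le_rfl] at h1
  exact (hlt (t₀ - r / 2) (by linarith) (by linarith)).ne h1.symm

end Counterexample

end PureSecondOrder

/-! ### The theorem. -/

theorem theorem3p5 (n : ℕ) (hn : 1 ≤ n) (F : Set (Matrix (Fin n) (Fin n) ℝ))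
    (hF : PureSecondOrder.IsSubequation F) (hb : PureSecondOrder.IsBorderline F) :
    -- (a)
    (PureSecondOrder.IntegralDivergesAtZero (PureSecondOrder.upperChar F) →
      PureSecondOrder.StrongMaxPrinciple F) ∧
    -- (b)
    (PureSecondOrder.IntegralConvergesAtZero (PureSecondOrder.lowerChar F) →
      ¬ PureSecondOrder.StrongMaxPrinciple F ∧
      ∃ (ψ : ℝ → ℝ) (t₀ m : ℝ), 1 < t₀ ∧
        DifferentiableOn ℝ ψ (Ioi 1) ∧
        (∃ C : NNReal, LipschitzOnWith C (deriv ψ) (Ioi 1)) ∧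
        MonotoneOn ψ (Ioi 1) ∧
        (∀ t : ℝ, 1 < t → t < t₀ → ψ t < m) ∧
        (∀ t : ℝ, t₀ ≤ t → ψ t = m) ∧
        PureSecondOrder.IsSubharmonicOn F {x : EuclideanSpace ℝ (Fin n) | 1 < ‖x‖}
          (fun x => ((ψ ‖x‖ : ℝ) : EReal))) ∧
    -- the invariant case
    (PureSecondOrder.IsInvariant F →
      PureSecondOrder.upperChar F = PureSecondOrder.lowerChar F ∧
      (PureSecondOrder.StrongMaxPrinciple F ↔
        PureSecondOrder.IntegralDivergesAtZero (PureSecondOrder.upperChar F))) := by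
  have hdecay : PureSecondOrder.IntegralConvergesAtZero (PureSecondOrder.lowerChar F) →
      ¬ PureSecondOrder.StrongMaxPrinciple F := fun hconv => by
    obtain ⟨ψ, t₀, m, ht₀, -, -, -, hlt, heq, hψ⟩ :=
      PureSecondOrder.exists_radial_subharmonic hn hF hb hconv
    exact PureSecondOrder.not_strongMaxPrinciple_of_radial hn ht₀ hlt heq hψ
  refine ⟨PureSecondOrder.strongMaxPrinciple_of_divergent hF, fun hconv =>
    ⟨hdecay hconv, PureSecondOrder.exists_radial_subharmonic hn hF hb hconv⟩, fun hI => ?_⟩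
  have heq := hI.upperChar_eq_lowerChar hn
  refine ⟨heq, fun hsmp => ?_, PureSecondOrder.strongMaxPrinciple_of_divergent hF⟩
  rw [heq]
  intro ε hε
  by_contra hne
  exact hdecay ⟨ε, hε, lt_top_iff_ne_top.2 hne⟩ hsmp
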